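/- Let $q\colon[0,\pi]\to\mathbb C$ be of class $C^2[0,\pi]$ and $a=\frac{\pi}{2}$. Consider the eigenvalue problem with frozen argument $$-y''(x)+q(x)\,y(a)=\lambda y(x),\quad x\in(0,\pi),\qquad y(0)=y(\pi)=0. \qquad (1)$$ With $\rho=\sqrt\lambda$, let $S(x,\lambda)=\frac{\sin\rho(x-a)}{\rho}$ and $C(x,\lambda)=\cos\rho(x-a)+\int_a^x q(t)\frac{\sin\rho(x-t)}{\rho}\,dt$. The multiplicity of an eigenvalue of (1) is its order as a zero of the entire function $\Delta(\lambda)=C(0,\lambda)S(\pi,\lambda)-C(\pi,\lambda)S(0,\lambda)$, and the eigenvalue is simple if its multiplicity is $1$. Let $\{\lambda_n\}_{n\ge1}$ be a list of all the eigenvalues of (1), counted with multiplicities, in which $\lambda_{2k}=(2k)^2$, $k\ge1$, are the degenerate eigenvalues; thus the non-degenerate eigenvalues have odd indices. For $m\in\mathbb N$ put $l=2m-1$, $h=\frac{\pi}{l+1}$, $q_j=q(jh)$, and consider the finite-difference problem $$-\frac{y_{j+1}-2y_j+y_{j-1}}{h^2}+q_jy_m=\lambda y_j,\quad j=1,\dots,l,\qquad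 y_0=y_{l+1}=0. \qquad (2)$$ It has $l$ eigenvalues counted with algebraic multiplicities; by a numbering $\{\lambda_{n,l}\}_{n=1}^{l}$ of them we mean one in which $\lambda_{2k,l}=\frac{4}{h^2}\sin^2(kh)$, $1\le k<m$, are the degenerate eigenvalues. We call numberings (one for each $l=2m-1$) matching if $\lambda_{n,l}\to\lambda_n$ as $l\to\infty$ for each fixed odd $n$ such that $\lambda_n\ne0$ is a simple eigenvalue of (1). Then matching numberings exist, and for all matching numberings $$\lambda_{n,l}=\lambda_n+O(h^2),\qquad l=2m-1\to\infty,$$ for odd $n$ such that $\lambda_n\neq0$ is a simple eigenvalue of (1), where the $O$-estimate is uniform with respect to such $n\le n_0$ for an arbitrary fixed integer $n_0$: there are $K$ and $M$, depending on $n_0$, such that $|\lambda_{n,l}-\lambda_n|\le K h^2$ for all $m\ge M$ and all such $n\le n_0$. -/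

import Mathlib

open Filter Topology

namespace FrozenArgument

noncomputable section

/-! ### The continuous problem `-y'' + q(x) y(a) = lam y` on `(0, π)`, `y(0) = y(π) = 0` -/

/-- `lam` is an eigenvalue: the boundary value problem has a nonzero solution. -/
def IsEigenvalue (a : ℝ) (q : ℝ → ℂ) (lam : ℂ) : Prop :=
  ∃ y : ℝ → ℂ, ContDiffOn ℝ 2 y (Set.Icc 0 Real.pi) ∧
    (∃ x ∈ Set.Icc 0 Real.pi, y x ≠ 0) ∧
    (∀ x ∈ Set.Ioo 0 Real.pi, -deriv (deriv y) x + q x * y a = lam * y x) ∧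
    y 0 = 0 ∧ y Real.pi = 0

/-- A square root of `lam`; the functions below do not depend on the choice of the branch. -/
def rho (lam : ℂ) : ℂ := lam ^ (1 / 2 : ℂ)

/-- `sin (ρ x) / ρ`, where `ρ ^ 2 = lam`, with its limit value `x` for `lam = 0`. -/
def sinKernel (lam : ℂ) (x : ℝ) : ℂ :=
  if lam = 0 then (x : ℂ) else Complex.sin (rho lam * x) / rho lam

/-- The solution `S(x, lam)` of the equation with `S(a) = 0`, `S'(a) = 1`. -/
def solS (a : ℝ) (lam : ℂ) (x : ℝ) : ℂ := sinKernel lam (x - a)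

/-- The solution `C(x, lam)` of the equation with `C(a) = 1`, `C'(a) = 0`. -/
def solC (a : ℝ) (q : ℝ → ℂ) (lam : ℂ) (x : ℝ) : ℂ :=
  Complex.cos (rho lam * ((x - a : ℝ) : ℂ)) + ∫ t in a..x, q t * sinKernel lam (x - t)

/-- The characteristic function `Δ(lam)`, an entire function. -/
def charFun (a : ℝ) (q : ℝ → ℂ) (lam : ℂ) : ℂ :=
  Matrix.det !![solC a q lam 0, solS a lam 0; solC a q lam Real.pi, solS a lam Real.pi]

open Classical in
/-- The (algebraic) multiplicity of an eigenvalue is its order as a zero of `Δ`;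
numbers that are not eigenvalues have multiplicity zero. -/
def multiplicity (a : ℝ) (q : ℝ → ℂ) (lam : ℂ) : ℕ∞ :=
  if IsEigenvalue a q lam then analyticOrderAt (charFun a q) lam else 0

/-- A simple eigenvalue of the boundary value problem. -/
def IsSimpleEigenvalue (a : ℝ) (q : ℝ → ℂ) (lam : ℂ) : Prop :=
  IsEigenvalue a q lam ∧ multiplicity a q lam = 1

/-- `lam 1, lam 2, …` is a list of all eigenvalues of the problem with `a = π / 2`, counted
with multiplicities, in which the even places are taken by the degenerate eigenvalues
`(2 k) ^ 2`; so the non-degenerate ones are at the odd places. (`lam 0` is not used.) -/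
structure IsEigenvalueNumbering (q : ℝ → ℂ) (lam : ℕ → ℂ) : Prop where
  even : ∀ k : ℕ, 1 ≤ k → lam (2 * k) = (2 * (k : ℂ)) ^ 2
  count : ∀ z : ℂ, {n : ℕ | 1 ≤ n ∧ lam n = z}.encard = multiplicity (Real.pi / 2) q z

/-! ### The finite-difference approximation -/

/-- The mesh width `h = π / (l + 1)`. -/
def step (l : ℕ) : ℝ := Real.pi / (l + 1)

/-- The `l × l` matrix of the system
`-(y_{j+1} - 2 y_j + y_{j-1}) / h ^ 2 + q(j h) y_m = lam y_j`, `1 ≤ j ≤ l`, with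
`y_0 = y_{l+1} = 0`. The index `i : Fin l` stands for `j = i + 1`. -/
def diffMatrix (l m : ℕ) (q : ℝ → ℂ) : Matrix (Fin l) (Fin l) ℂ :=
  Matrix.of fun i k =>
    ((if k = i then 2 else 0) - (if (k : ℕ) = i + 1 then 1 else 0)
        - (if (k : ℕ) + 1 = i then 1 else 0)) / (step l : ℂ) ^ 2
      + (if (k : ℕ) + 1 = m then q (((i : ℕ) + 1) * step l) else 0)

/-- `mu l 1, …, mu l l` are, for each `l = 2 m - 1`, all the eigenvalues of the discrete problem
counted with (algebraic) multiplicities, and the even places are taken by the degenerate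
eigenvalues `4 sin² (n h / 2) / h²`. (Other values of `mu` are not used.) -/
structure IsDiscreteNumbering (q : ℝ → ℂ) (mu : ℕ → ℕ → ℂ) : Prop where
  even : ∀ m : ℕ, 1 ≤ m → ∀ k : ℕ, 1 ≤ k → k < m →
    mu (2 * m - 1) (2 * k) =
      ((4 * Real.sin (((2 * k : ℕ) : ℝ) * step (2 * m - 1) / 2) ^ 2 /
        step (2 * m - 1) ^ 2 : ℝ) : ℂ)
  roots : ∀ m : ℕ, 1 ≤ m →
    (Finset.Icc 1 (2 * m - 1)).val.map (mu (2 * m - 1)) =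
      (diffMatrix (2 * m - 1) m q).charpoly.roots

/-- The numbering of the discrete eigenvalues matches that of the continuous ones:
`mu l n → lam n` as `l = 2 m - 1 → ∞`, for each fixed odd `n` such that `lam n` is a nonzero
simple eigenvalue. -/
def Matches (q : ℝ → ℂ) (lam : ℕ → ℂ) (mu : ℕ → ℕ → ℂ) : Prop :=
  ∀ n : ℕ, Odd n → lam n ≠ 0 → IsSimpleEigenvalue (Real.pi / 2) q (lam n) →
    Tendsto (fun m : ℕ => mu (2 * m - 1) n) atTop (𝓝 (lam n))

end

end FrozenArgument

/-! Since `a = π / 2` is the midpoint, `Δ` splits as `Δ(z) = s(z) f(z)` with `s(z) = sin (ρ π / 2) /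
ρ` and `f` = `charFactor` (`charFun_eq`); the zeros of `s` are the degenerate eigenvalues. The
discrete problem has the same structure: up to sign and a power of `h`, its characteristic
polynomial is `s_m F`, where `s_j` is the three-term analogue of the kernel `sin (ρ x) / ρ` and `F`
= `discF` (`charpoly_diffMatrix`).

Consistency and stability of the recurrence give `s_j = sin (ρ j h) / ρ + O(h²)`, with first
differences accurate to `O(h³)` (`discS_sub_sinKernel_le`). The sum in `F` is a trapezoidal sum for
the integral in `f`, of second order because `q` is `C²`. Hence `s_m F / h = Δ + O(h²)` uniformly on
discs (`discChar_approx`).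

At a simple zero `w` one has `‖Δ(z)‖ ≥ c ‖z - w‖` nearby, so every discrete eigenvalue that stays in
a fixed small disc about `w` is within `O(h²)` of `w` (`roots_near_simple_zero`). This is the rate
for any matching numbering. A quantitative open mapping theorem shows that such a discrete
eigenvalue exists, and it is not a zero of `s_m` when `s(w) ≠ 0` (`exists_root_near_simple_zero`).
The roots chosen near distinct simple eigenvalues are distinct from each other and from the
degenerate ones, so they extend to a full enumeration, which is a matching numbering. -/

namespace FrozenArgument

noncomputable section

/-! ### Factorization of the discrete characteristic polynomial -/

section Discrete
open Polynomial

/-- The determinant of a matrix that is triangular with respect to an injective grading. -/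
theorem det_of_blockTriangular_injective {ι R : Type*} [Fintype ι] [DecidableEq ι] [CommRing R]
    (M : Matrix ι ι R) (b : ι → ℕ) (hb : Function.Injective b) (hM : M.BlockTriangular b) :
    M.det = ∏ i, M i i := by
  let _ : LinearOrder ι := LinearOrder.lift' b hb
  have h : M.BlockTriangular id := fun i j hij => hM hij
  convert Matrix.det_of_isUpperTriangular h

/-- The polynomials `s_j` in the spectral parameter with `s_0 = 0`, `s_1 = h` and
`s_{j+1} - 2 s_j + s_{j-1} = -h ^ 2 X s_j`. -/
def discS (h : ℝ) : ℕ → ℂ[X]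
  | 0 => 0
  | 1 => C (h : ℂ)
  | (j + 2) => (C 2 - C ((h : ℂ) ^ 2) * X) * discS h (j + 1) - discS h j

theorem discS_add_two (h : ℝ) (j : ℕ) :
    discS h (j + 2) = (C 2 - C ((h : ℂ) ^ 2) * X) * discS h (j + 1) - discS h j := by
  rw [discS]

/-- At spectral parameter zero the recurrence says that second differences vanish. This value serves
to show that the polynomials `s_j`, `j ≥ 1`, are nonzero and can be cancelled. -/
theorem eval_discS_zero (h : ℝ) (j : ℕ) : (discS h j).eval 0 = j * h := by
  induction j using Nat.twoStepInduction with
  | zero => simp [discS]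
  | one => simp [discS]
  | more j h1 h2 =>
    simp only [discS_add_two, eval_sub, eval_mul, h1, h2, eval_C, eval_X]
    push_cast
    ring

theorem discS_ne_zero {h : ℝ} (hh : h ≠ 0) {j : ℕ} (hj : j ≠ 0) : discS h j ≠ 0 := by
  intro h0
  have := eval_discS_zero h j
  rw [h0, eval_zero] at this
  simp_all

/-- The nontrivial factor of the characteristic polynomial of the discrete problem, where `Q j`
is the value of the potential at the node `j`. -/
def discF (h : ℝ) (m : ℕ) (Q : ℕ → ℂ) : ℂ[X] :=
  discS h (m + 1) - discS h (m - 1) +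
    C ((h : ℂ) ^ 2) * (∑ i ∈ Finset.range (m - 1),
      discS h (i + 1) * C (Q (i + 1) + Q (2 * m - (i + 1))) + discS h m * C (Q m))

/-- The rows by which the discrete system is multiplied in the elimination of the unknowns. -/
def elimRow (h : ℝ) (m I J : ℕ) : ℂ[X] :=
  if I < m then (if J ≤ I then discS h J else 0)
  else if I = m then (if J ≤ m then discS h J else discS h (2 * m - J))
  else (if I ≤ J then discS h (2 * m - J) else 0)

/-- The two hypotheses are the boundary conditions `r_0 = r_{l+1} = 0`: with them the formula
survives when `t` falls just outside `1, …, l`, so no case split is needed in the first and last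
columns. -/
theorem sum_fin_mul_ite {l : ℕ} (r : ℕ → ℂ[X]) {t : ℕ} (ht : t = 0 → r 0 = 0)
    (ht' : l < t → r t = 0) :
    ∑ j : Fin l, r ((j : ℕ) + 1) * (if t = (j : ℕ) + 1 then 1 else 0) = r t := by
  rw [Fin.sum_univ_eq_sum_range (fun j => r (j + 1) * (if t = j + 1 then 1 else 0))]
  rcases t with _ | t
  · simp [ht]
  · simp only [Nat.add_right_cancel_iff, mul_ite, mul_one, mul_zero, Finset.sum_ite_eq,
      Finset.mem_range]
    split_ifs with h
    · rfl
    · rw [ht' (by omega)]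

/-- Multiplication of a row by the scaled characteristic matrix of the discrete problem. -/
theorem sum_row_mul_charmatrix {l m : ℕ} (q : ℝ → ℂ) (r : ℕ → ℂ[X]) (h0 : r 0 = 0)
    (hl : r (l + 1) = 0) (k : Fin l) :
    ∑ j : Fin l, r ((j : ℕ) + 1) *
        (C ((step l : ℂ) ^ 2) * (Matrix.charmatrix (diffMatrix l m q)) j k) =
      -((C 2 - C ((step l : ℂ) ^ 2) * X) * r ((k : ℕ) + 1)) + r k + r ((k : ℕ) + 2) -
      if (k : ℕ) + 1 = m then
        C ((step l : ℂ) ^ 2) * ∑ j : Fin l, r ((j : ℕ) + 1) *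
          C (q ((((j : ℕ) + 1 : ℕ) : ℝ) * step l)) else 0 := by
  have hs : (step l : ℂ) ≠ 0 := by
    have : step l ≠ 0 := by unfold step; positivity
    exact_mod_cast this
  have e1 := sum_fin_mul_ite (l := l) r (t := (k : ℕ) + 1) (by simp) (by
    intro h; omega)
  have e2 := sum_fin_mul_ite (l := l) r (t := (k : ℕ)) (fun h => h0) (by
    intro h; omega)
  have e3 := sum_fin_mul_ite (l := l) r (t := (k : ℕ) + 2) (by simp) (by
    intro h; have : (k : ℕ) + 2 = l + 1 := by omega
    rw [this, hl])
  rw [← e2, ← e3, ← e1]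
  have e4 : (if (k : ℕ) + 1 = m then
        C ((step l : ℂ) ^ 2) * ∑ j : Fin l, r ((j : ℕ) + 1) *
          C (q ((((j : ℕ) + 1 : ℕ) : ℝ) * step l)) else 0) =
      ∑ j : Fin l, if (k : ℕ) + 1 = m then C ((step l : ℂ) ^ 2) * (r ((j : ℕ) + 1) *
          C (q ((((j : ℕ) + 1 : ℕ) : ℝ) * step l))) else 0 := by
    split_ifs <;> simp [Finset.mul_sum]
  rw [e4, Finset.mul_sum, ← Finset.sum_neg_distrib, ← Finset.sum_add_distrib,
    ← Finset.sum_add_distrib, ← Finset.sum_sub_distrib]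
  refine Finset.sum_congr rfl fun j _ => ?_
  have e5 : C ((step l : ℂ) ^ 2) * (Matrix.charmatrix (diffMatrix l m q)) j k =
      -((C 2 - C ((step l : ℂ) ^ 2) * X) * (if (k : ℕ) + 1 = (j : ℕ) + 1 then 1 else 0)) +
      (if (k : ℕ) = (j : ℕ) + 1 then 1 else 0) + (if (k : ℕ) + 2 = (j : ℕ) + 1 then 1 else 0) -
      (if (k : ℕ) + 1 = m then C ((step l : ℂ) ^ 2) *
        C (q ((((j : ℕ) + 1 : ℕ) : ℝ) * step l)) else 0) := by
    rw [Matrix.charmatrix_apply, mul_sub, ← C_mul, diffMatrix, Matrix.of_apply, mul_add,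
      mul_div_cancel₀ _ (pow_ne_zero 2 hs), C_add, C_sub, C_sub, C_mul]
    have c1 : (Matrix.diagonal (fun _ : Fin l => (X : ℂ[X]))) j k =
        X * (if (k : ℕ) + 1 = (j : ℕ) + 1 then 1 else 0) := by
      rw [Matrix.diagonal_apply]
      simp [Fin.ext_iff, eq_comm]
    rw [c1]
    have c2 : (k = j) ↔ ((k : ℕ) + 1 = (j : ℕ) + 1) := by rw [Fin.ext_iff]; omega
    have c3 : ((k : ℕ) + 1 = (j : ℕ)) ↔ ((k : ℕ) + 2 = (j : ℕ) + 1) := by omega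
    simp only [c2, c3]
    push_cast
    split_ifs <;> simp <;> ring
  rw [e5]
  split_ifs <;> ring

theorem prod_fin_fold {R : Type*} [CommMonoid R] {l m : ℕ} (hl : l + 1 = 2 * m) (f : ℕ → R) :
    ∏ j : Fin l, f ((j : ℕ) + 1) =
      (∏ i ∈ Finset.range (m - 1), f (i + 1) * f (2 * m - (i + 1))) * f m := by
  obtain ⟨n, rfl⟩ : ∃ n, m = n + 1 := ⟨m - 1, by omega⟩
  obtain rfl : l = n + (1 + n) := by omega
  rw [Fin.prod_univ_eq_prod_range (fun j => f (j + 1)), Finset.prod_range_add,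
    Finset.prod_range_add, ← Finset.prod_range_reflect (fun x => f (n + (1 + x) + 1)),
    Finset.prod_mul_distrib]
  simp only [Finset.prod_range_one, Nat.add_sub_cancel, add_zero]
  rw [mul_comm (f (n + 1)), mul_assoc]
  congr 2
  refine Finset.prod_congr rfl fun i hi => ?_
  rw [Finset.mem_range] at hi
  congr 1
  omega

theorem sum_fin_fold {R : Type*} [AddCommMonoid R] {l m : ℕ} (hl : l + 1 = 2 * m) (f : ℕ → R) :
    ∑ j : Fin l, f ((j : ℕ) + 1) =
      (∑ i ∈ Finset.range (m - 1), (f (i + 1) + f (2 * m - (i + 1)))) + f m :=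
  prod_fin_fold (R := Multiplicative R) hl f

/-- The factorization of the characteristic polynomial of the discrete problem. -/
theorem charpoly_diffMatrix {l m : ℕ} (hm : 1 ≤ m) (hl : l + 1 = 2 * m) (q : ℝ → ℂ) :
    C ((step l : ℂ) ^ 2) ^ (l + 1) * (diffMatrix l m q).charpoly =
      -(discF (step l) m (fun j => q (j * step l)) * discS (step l) m) := by
  set h := step l with hh
  have hs : h ≠ 0 := by rw [hh]; unfold step; positivity
  set B : Matrix (Fin l) (Fin l) ℂ[X] :=
    Matrix.of fun j k => C ((h : ℂ) ^ 2) * (Matrix.charmatrix (diffMatrix l m q)) j k with hB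
  have hBdet : B.det = C ((h : ℂ) ^ 2) ^ l * (diffMatrix l m q).charpoly := by
    have : B = C ((h : ℂ) ^ 2) • Matrix.charmatrix (diffMatrix l m q) := by
      ext1; rfl
    rw [this, Matrix.det_smul, Fintype.card_fin, Matrix.charpoly]
  set R : Matrix (Fin l) (Fin l) ℂ[X] := Matrix.of fun i j => elimRow h m (i + 1) (j + 1) with hR
  -- The grade orders the nodes from both ends towards the middle, the left node of a mirror pair
  -- coming first; the node `m` has the largest grade.
  let b : Fin l → ℕ := fun i =>
    2 * min ((i : ℕ) + 1) (2 * m - ((i : ℕ) + 1)) + if m < (i : ℕ) + 1 then 1 else 0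
  have hbinj : Function.Injective b := by
    intro i j hij
    simp only [b] at hij
    ext
    split_ifs at hij <;> omega
  have hRB (i k : Fin l) : (R * B) i k =
      -((C 2 - C ((h : ℂ) ^ 2) * X) * elimRow h m (i + 1) (k + 1)) + elimRow h m (i + 1) k +
        elimRow h m (i + 1) (k + 2) - if (k : ℕ) + 1 = m then
        C ((h : ℂ) ^ 2) * ∑ j : Fin l, elimRow h m (i + 1) ((j : ℕ) + 1) *
          C (q ((((j : ℕ) + 1 : ℕ) : ℝ) * h)) else 0 := by
    rw [Matrix.mul_apply]
    refine sum_row_mul_charmatrix q (elimRow h m (i + 1)) ?_ ?_ k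
    · unfold elimRow
      split_ifs <;> simp_all [discS]
    · rw [hl]
      unfold elimRow
      split_ifs <;> first | omega | simp [discS]
  have hrec (j : ℕ) (hj : 1 ≤ j) : -((C 2 - C ((h : ℂ) ^ 2) * X) * discS h j) + discS h (j - 1) +
      discS h (j + 1) = 0 := by
    obtain ⟨j, rfl⟩ : ∃ t, j = t + 1 := ⟨j - 1, by omega⟩
    rw [discS_add_two, Nat.add_sub_cancel]
    ring
  have hRBdet := det_of_blockTriangular_injective (R * B) b hbinj (by
    intro i k hki
    have hi := i.2
    have hk := k.2
    -- Column `m`, the only one containing the potential, has the top grade, so it never has to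
    -- vanish. In the other columns the entries vanish by the recurrence or because the row is zero
    -- there.
    have hkm : (k : ℕ) + 1 ≠ m := by
      intro hkm
      simp only [b] at hki
      split_ifs at hki <;> omega
    rw [hRB, if_neg hkm, sub_zero]
    simp only [b] at hki
    unfold elimRow
    rcases lt_trichotomy ((i : ℕ) + 1) m with him | him | him
    · simp only [if_pos him]
      by_cases hki' : (k : ℕ) + 1 ≤ i
      · rw [if_pos (by omega), if_pos (by omega), if_pos (by omega)]
        exact hrec (k + 1) (by omega)
      · rw [if_neg, if_neg, if_neg]
        · simp
        all_goals split_ifs at hki <;> omega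
    · simp only [him, lt_irrefl, if_false, if_true]
      by_cases hkm' : (k : ℕ) + 1 < m
      · rw [if_pos (by omega), if_pos (by omega), if_pos (by omega)]
        exact hrec (k + 1) (by omega)
      · have e : (if (k : ℕ) ≤ m then discS h k else discS h (2 * m - k)) =
            discS h (2 * m - k) := by
          split_ifs with hc
          · congr 1; omega
          · rfl
        rw [if_neg (show ¬ ((k : ℕ) + 1 ≤ m) by omega), e,
          if_neg (show ¬ ((k : ℕ) + 2 ≤ m) by omega)]
        have := hrec (2 * m - (k + 1)) (by omega)
        rw [show 2 * m - (k + 1) - 1 = 2 * m - (k + 2 : ℕ) by omega,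
          show 2 * m - (k + 1) + 1 = 2 * m - (k : ℕ) by omega] at this
        rw [← this]; ring
    · simp only [if_neg (show ¬ ((i : ℕ) + 1 < m) by omega),
        if_neg (show ¬ ((i : ℕ) + 1 = m) by omega)]
      by_cases hki' : (i : ℕ) + 1 ≤ k
      · rw [if_pos (by omega), if_pos (by omega), if_pos (by omega)]
        have := hrec (2 * m - (k + 1)) (by omega)
        rw [show 2 * m - (k + 1) - 1 = 2 * m - (k + 2 : ℕ) by omega,
          show 2 * m - (k + 1) + 1 = 2 * m - (k : ℕ) by omega] at this
        rw [← this]; ring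
      · rw [if_neg, if_neg, if_neg]
        · simp
        all_goals split_ifs at hki <;> omega)
  have hRdet := det_of_blockTriangular_injective R.transpose b hbinj (by
    intro i k hki
    have hi := i.2
    have hk := k.2
    simp only [b] at hki
    simp only [hR, Matrix.transpose_apply, Matrix.of_apply]
    unfold elimRow
    split_ifs at hki ⊢ <;> first | rfl | omega)
  rw [Matrix.det_transpose] at hRdet
  have d1 : ∏ i, R.transpose i i =
      (∏ i ∈ Finset.range (m - 1), discS h (i + 1)) ^ 2 * discS h m := by
    simp only [hR, Matrix.transpose_apply, Matrix.of_apply]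
    rw [prod_fin_fold hl (fun j => elimRow h m j j), sq, ← Finset.prod_mul_distrib]
    congr 1
    · refine Finset.prod_congr rfl fun i hi => ?_
      rw [Finset.mem_range] at hi
      unfold elimRow
      rw [if_pos (by omega), if_pos le_rfl, if_neg (by omega), if_neg (by omega), if_pos le_rfl]
      congr 2
      omega
    · simp [elimRow]
  have hsum : ∑ j : Fin l, elimRow h m m ((j : ℕ) + 1) * C (q ((((j : ℕ) + 1 : ℕ) : ℝ) * h)) =
      ∑ i ∈ Finset.range (m - 1), discS h (i + 1) *
        C (q ((i + 1 : ℕ) * h) + q ((2 * m - (i + 1) : ℕ) * h)) + discS h m * C (q (m * h)) := by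
    rw [sum_fin_fold hl (fun j => elimRow h m m j * C (q ((j : ℝ) * h)))]
    congr 1
    · refine Finset.sum_congr rfl fun i hi => ?_
      rw [Finset.mem_range] at hi
      simp only [elimRow, lt_irrefl, if_false, if_true]
      rw [if_pos (by omega), if_neg (by omega), C_add,
        show 2 * m - (2 * m - (i + 1)) = i + 1 by omega]
      ring
    · simp [elimRow]
  let D : ℕ → ℂ[X] := fun I => if I < m then -discS h (I + 1) else if I = m then
    -discF h m (fun j => q (j * h)) else -discS h (2 * m - I + 1)
  have d2 (i : Fin l) : (R * B) i i = D (i + 1) := by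
    have hi := i.2
    rw [hRB]
    simp only [D]
    split_ifs with h1 h2 h2
    · omega
    -- In the middle entry both neighbours contribute `s_{m-1}`, and `2 s_{m-1} - (2 - h² X) s_m =
    -- s_{m-1} - s_{m+1}`.
    · rw [h1, hsum]
      simp only [elimRow, lt_irrefl, if_false, if_true, le_refl]
      rw [if_pos (by omega), if_neg (by omega)]
      obtain ⟨n, hn⟩ : ∃ n, m = n + 1 := ⟨m - 1, by omega⟩
      rw [discF, show 2 * m - (i + 2) = m - 1 by omega, show (i : ℕ) = m - 1 by omega]
      subst hn
      rw [discS_add_two, Nat.add_sub_cancel]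
      ring
    · simp only [elimRow, if_pos h2]
      rw [if_pos le_rfl, if_pos (by omega), if_neg (by omega), discS_add_two]
      ring
    · simp only [elimRow, if_neg h2, if_neg h1]
      rw [if_pos le_rfl, if_neg (by omega), if_pos (by omega)]
      have := hrec (2 * m - (i + 1)) (by omega)
      rw [show 2 * m - (i + 1) - 1 = 2 * m - (i + 2 : ℕ) by omega] at this
      linear_combination this
  have d3 : ∏ i, (R * B) i i =
      -((∏ i ∈ Finset.range (m - 1), discS h (i + 1 + 1)) ^ 2 * discF h m (fun j => q (j * h))) := by
    simp only [d2]
    rw [prod_fin_fold hl D, sq, ← Finset.prod_mul_distrib, ← mul_neg]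
    congr 1
    · refine Finset.prod_congr rfl fun i hi => ?_
      rw [Finset.mem_range] at hi
      simp only [D]
      rw [if_pos (by omega), if_neg (by omega), if_neg (by omega),
        show 2 * m - (2 * m - (i + 1)) = i + 1 by omega]
      ring
    · simp [D]
  -- The product `s_2 ⋯ s_m` is that of `s_1 ⋯ s_{m-1}` times `s_m / s_1`, and `s_1 = h`; so the
  -- diagonals of `R` and `R * B` almost cancel.
  have d4 : (∏ i ∈ Finset.range (m - 1), discS h (i + 1 + 1)) * C (h : ℂ) =
      (∏ i ∈ Finset.range (m - 1), discS h (i + 1)) * discS h m := by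
    have := Finset.prod_range_succ' (fun i => discS h (i + 1)) (m - 1)
    rw [Finset.prod_range_succ, show m - 1 + 1 = m by omega] at this
    rw [this]
    simp [discS]
  have hP : (∏ i ∈ Finset.range (m - 1), discS h (i + 1)) ^ 2 * discS h m ≠ 0 := by
    refine mul_ne_zero (pow_ne_zero 2 (Finset.prod_ne_zero_iff.2 fun i _ => ?_)) ?_
    · exact discS_ne_zero hs (by omega)
    · exact discS_ne_zero hs (by omega)
  have key : R.det * B.det = (R * B).det := (Matrix.det_mul R B).symm
  rw [hRdet, hRBdet, d1, d3, hBdet] at key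
  refine mul_left_cancel₀ hP ?_
  rw [pow_succ, C_pow]
  rw [C_pow] at key
  have d5 := congrArg (fun p => p ^ 2) d4
  simp only [mul_pow] at d5
  linear_combination (C (h : ℂ)) ^ 2 * key - discF h m (fun j => q (j * h)) * d5

/-- The values of `s_j` at `4 sin² (θ / 2) / h²` in terms of sines. -/
theorem eval_discS_sin (h : ℝ) (θ : ℝ) (hh : h ≠ 0) (j : ℕ) :
    (discS h j).eval ((4 * Real.sin (θ / 2) ^ 2 / h ^ 2 : ℝ) : ℂ) * (Real.sin θ : ℂ) =
      h * (Real.sin (j * θ) : ℂ) := by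
  have hc : (h : ℂ) ≠ 0 := by exact_mod_cast hh
  induction j using Nat.twoStepInduction with
  | zero => simp [discS]
  | one => simp [discS]
  | more j h1 h2 =>
    simp only [discS_add_two, eval_sub, eval_mul, eval_C, eval_X]
    rw [sub_mul, mul_assoc, h1, h2]
    -- At this spectral value `2 - h² λ = 2 cos θ`, so the recurrence is that of `sin (j θ)`.
    have e : ((h : ℂ) ^ 2 * ((4 * Real.sin (θ / 2) ^ 2 / h ^ 2 : ℝ) : ℂ)) =
        ((2 - 2 * Real.cos θ : ℝ) : ℂ) := by
      have : h ^ 2 * (4 * Real.sin (θ / 2) ^ 2 / h ^ 2) = 2 - 2 * Real.cos θ := by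
        rw [mul_div_cancel₀ _ (pow_ne_zero 2 hh)]
        have := Real.cos_two_mul (θ / 2)
        rw [show 2 * (θ / 2) = θ by ring] at this
        rw [this, Real.cos_sq']
        ring
      rw [← this]; push_cast; ring
    rw [e]
    have e2 : Real.sin ((j + 2 : ℕ) * θ) = 2 * Real.cos θ * Real.sin ((j + 1 : ℕ) * θ) -
        Real.sin (j * θ) := by
      push_cast
      rw [show (j + 2 : ℝ) * θ = (j + 1) * θ + θ by ring, show (j : ℝ) * θ = (j + 1) * θ - θ by ring,
        Real.sin_add, Real.sin_sub]
      ring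
    rw [e2]
    push_cast
    ring

end Discrete

/-! ### Trapezoidal rule for complex-valued functions -/

section Trapezoid

theorem abs_trapezoidal_error_le_of_deriv {g g1 g2 : ℝ → ℝ} {b ζ : ℝ} (hb : 0 < b)
    (h1 : ∀ t ∈ Set.Icc 0 b, HasDerivWithinAt g (g1 t) (Set.Icc 0 b) t)
    (h2 : ∀ t ∈ Set.Icc 0 b, HasDerivWithinAt g1 (g2 t) (Set.Icc 0 b) t)
    (hζ : ∀ t ∈ Set.Icc 0 b, |g2 t| ≤ ζ) {N : ℕ} (hN : 0 < N) :
    |trapezoidal_error g N 0 b| ≤ b ^ 3 * ζ / (12 * N ^ 2) := by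
  have hu : UniqueDiffOn ℝ (Set.Icc 0 b) := uniqueDiffOn_Icc hb
  have hd1 : ∀ t ∈ Set.Icc 0 b, derivWithin g (Set.Icc 0 b) t = g1 t :=
    fun t ht => (h1 t ht).derivWithin (hu t ht)
  have hd2 : ∀ t ∈ Set.Icc 0 b, HasDerivWithinAt (derivWithin g (Set.Icc 0 b)) (g2 t)
      (Set.Icc 0 b) t := fun t ht => (h2 t ht).congr hd1 (hd1 t ht)
  have hζ0 : 0 ≤ ζ := (abs_nonneg _).trans (hζ 0 ⟨le_rfl, hb.le⟩)
  have key := trapezoidal_error_le (f := g) (a := 0) (b := b) (ζ := ζ)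
    (by rw [Set.uIcc_of_le hb.le]; exact fun t ht => (h1 t ht).differentiableWithinAt)
    (by rw [Set.uIcc_of_le hb.le]; exact fun t ht => (hd2 t ht).differentiableWithinAt)
    (by
      rw [Set.uIcc_of_le hb.le]
      intro x
      rw [iteratedDerivWithin_eq_iterate]
      change |derivWithin (derivWithin g (Set.Icc 0 b)) (Set.Icc 0 b) x| ≤ ζ
      by_cases hx : x ∈ Set.Icc 0 b
      · rw [(hd2 x hx).derivWithin (hu x hx)]
        exact hζ x hx
      -- The bound is required at every real `x`; off the interval `derivWithin` takes its default
      -- value zero.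
      · rw [derivWithin_zero_of_notMem_closure (by rwa [isClosed_Icc.closure_eq]), abs_zero]
        exact hζ0) hN
  rwa [sub_zero, abs_of_pos hb] at key

/-- The error of the trapezoidal rule for complex-valued functions. -/
theorem norm_trapezoid_sub_integral_le {g g1 g2 : ℝ → ℂ} {b ζ : ℝ} (hb : 0 < b)
    (h1 : ∀ t ∈ Set.Icc 0 b, HasDerivWithinAt g (g1 t) (Set.Icc 0 b) t)
    (h2 : ∀ t ∈ Set.Icc 0 b, HasDerivWithinAt g1 (g2 t) (Set.Icc 0 b) t)
    (hζ : ∀ t ∈ Set.Icc 0 b, ‖g2 t‖ ≤ ζ) {N : ℕ} (hN : 0 < N) :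
    ‖((b / N : ℝ) : ℂ) * ((g 0 + g b) / 2 +
        ∑ k ∈ Finset.range (N - 1), g ((k + 1 : ℕ) * (b / N))) - ∫ t in (0 : ℝ)..b, g t‖ ≤
      b ^ 3 * ζ / N ^ 2 := by
  have hint : IntervalIntegrable g MeasureTheory.volume 0 b := by
    refine ContinuousOn.intervalIntegrable ?_
    rw [Set.uIcc_of_le hb.le]
    exact fun t ht => (h1 t ht).continuousWithinAt
  have hre := abs_trapezoidal_error_le_of_deriv hb
    (fun t ht => Complex.reCLM.hasFDerivAt.comp_hasDerivWithinAt t (h1 t ht))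
    (fun t ht => Complex.reCLM.hasFDerivAt.comp_hasDerivWithinAt t (h2 t ht))
    (fun t ht => (Complex.abs_re_le_norm _).trans (hζ t ht)) hN
  have him := abs_trapezoidal_error_le_of_deriv hb
    (fun t ht => Complex.imCLM.hasFDerivAt.comp_hasDerivWithinAt t (h1 t ht))
    (fun t ht => Complex.imCLM.hasFDerivAt.comp_hasDerivWithinAt t (h2 t ht))
    (fun t ht => (Complex.abs_im_le_norm _).trans (hζ t ht)) hN
  have hζ0 : 0 ≤ ζ := (norm_nonneg _).trans (hζ 0 ⟨le_rfl, hb.le⟩)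
  -- Real and imaginary parts each cost `1 / 12`, and `1 / 12 + 1 / 12 ≤ 1`.
  have hz : b ^ 3 * ζ / (12 * N ^ 2) + b ^ 3 * ζ / (12 * N ^ 2) ≤ b ^ 3 * ζ / N ^ 2 := by
    have hpos : 0 ≤ b ^ 3 * ζ / (N : ℝ) ^ 2 := by positivity
    have e : b ^ 3 * ζ / (12 * (N : ℝ) ^ 2) = b ^ 3 * ζ / (N : ℝ) ^ 2 / 12 := by
      rw [div_div, mul_comm (12 : ℝ)]
    rw [e]; linarith
  refine (Complex.norm_le_abs_re_add_abs_im _).trans (le_trans (add_le_add ?_ ?_) hz)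
  · refine le_trans (le_of_eq ?_) hre
    rw [trapezoidal_error, trapezoidal_integral]
    have := Complex.reCLM.intervalIntegral_comp_comm hint
    simp only [Complex.reCLM_apply] at this
    simp only [Function.comp_apply, Complex.reCLM_apply, this, Complex.sub_re,
      Complex.re_ofReal_mul, Complex.add_re, Complex.re_sum, Complex.div_ofNat_re, sub_zero,
      zero_add, mul_div_assoc, Nat.cast_add, Nat.cast_one]
  · refine le_trans (le_of_eq ?_) him
    rw [trapezoidal_error, trapezoidal_integral]
    have := Complex.imCLM.intervalIntegral_comp_comm hint
    simp only [Complex.imCLM_apply] at this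
    simp only [Function.comp_apply, Complex.imCLM_apply, this, Complex.sub_im,
      Complex.im_ofReal_mul, Complex.add_im, Complex.im_sum, Complex.div_ofNat_im, sub_zero,
      zero_add, mul_div_assoc, Nat.cast_add, Nat.cast_one]

end Trapezoid

/-! ### The kernel `sin (ρ x) / ρ` and its discrete analogue -/

section Kernel

theorem rho_sq (z : ℂ) : rho z ^ 2 = z := by
  have := Complex.cpow_nat_inv_pow z (n := 2) two_ne_zero
  rw [rho, one_div]
  exact_mod_cast this

theorem rho_ne_zero {z : ℂ} (hz : z ≠ 0) : rho z ≠ 0 := by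
  intro h
  apply hz
  rw [← rho_sq z, h, zero_pow two_ne_zero]

theorem rho_zero : rho 0 = 0 := by
  have := rho_sq 0
  exact pow_eq_zero_iff two_ne_zero |>.1 this

theorem norm_rho_sq (z : ℂ) : ‖rho z‖ ^ 2 = ‖z‖ := by
  rw [← norm_pow, rho_sq]

theorem sinKernel_zero_right (z : ℂ) : sinKernel z 0 = 0 := by
  unfold sinKernel; split_ifs <;> simp

theorem sinKernel_neg (z : ℂ) (x : ℝ) : sinKernel z (-x) = -sinKernel z x := by
  unfold sinKernel; split_ifs
  · simp
  · simp [neg_div]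

theorem rho_mul_sinKernel (z : ℂ) (x : ℝ) : rho z * sinKernel z x = Complex.sin (rho z * x) := by
  unfold sinKernel; split_ifs with h
  · simp [h, rho_zero]
  · field_simp [rho_ne_zero h]

theorem hasDerivAt_sinKernel (z : ℂ) (x : ℝ) :
    HasDerivAt (sinKernel z) (Complex.cos (rho z * x)) x := by
  by_cases h : z = 0
  · have e : sinKernel z = fun x : ℝ => (x : ℂ) := by
      funext x; simp [sinKernel, h]
    rw [e, h, rho_zero]
    simpa using (hasDerivAt_id (x : ℂ)).comp_ofReal
  · have e : sinKernel z = fun x : ℝ => Complex.sin (rho z * x) / rho z := by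
      funext x; simp [sinKernel, h]
    rw [e]
    have h1 : HasDerivAt (fun w : ℂ => rho z * w) (rho z) (x : ℂ) := by
      simpa using (hasDerivAt_id (x : ℂ)).const_mul (rho z)
    have h2 := (h1.csin.div_const (rho z)).comp_ofReal
    rwa [mul_div_cancel_right₀ _ (rho_ne_zero h)] at h2

theorem hasDerivAt_cos_rho (z : ℂ) (x : ℝ) :
    HasDerivAt (fun x : ℝ => Complex.cos (rho z * x)) (-(z * sinKernel z x)) x := by
  have h1 : HasDerivAt (fun w : ℂ => rho z * w) (rho z) (x : ℂ) := by
    simpa using (hasDerivAt_id (x : ℂ)).const_mul (rho z)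
  have h2 := h1.ccos.comp_ofReal
  convert h2 using 1
  rw [← rho_mul_sinKernel]
  linear_combination sinKernel z x * rho_sq z

theorem norm_cos_le_exp (w : ℂ) : ‖Complex.cos w‖ ≤ Real.exp ‖w‖ := by
  have h1 : ‖Complex.exp (w * Complex.I)‖ ≤ Real.exp ‖w‖ := by
    simpa using Complex.norm_exp_le_exp_norm (w * Complex.I)
  have h2 : ‖Complex.exp (-w * Complex.I)‖ ≤ Real.exp ‖w‖ := by
    simpa using Complex.norm_exp_le_exp_norm (-w * Complex.I)
  rw [Complex.cos, norm_div, Complex.norm_two]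
  have := norm_add_le (Complex.exp (w * Complex.I)) (Complex.exp (-w * Complex.I))
  linarith

theorem norm_rho_le {z : ℂ} {L : ℝ} (hz : ‖z‖ ≤ L) : ‖rho z‖ ≤ √L := by
  apply Real.le_sqrt_of_sq_le
  rwa [norm_rho_sq]

theorem norm_cos_rho_le {z : ℂ} {L X x : ℝ} (hz : ‖z‖ ≤ L) (hx : |x| ≤ X) :
    ‖Complex.cos (rho z * x)‖ ≤ Real.exp (√L * X) := by
  refine (norm_cos_le_exp _).trans (Real.exp_le_exp.2 ?_)
  rw [norm_mul, Complex.norm_real, Real.norm_eq_abs]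
  exact mul_le_mul (norm_rho_le hz) hx (abs_nonneg _) (Real.sqrt_nonneg _)

theorem norm_sinKernel_le {z : ℂ} {L X x : ℝ} (hz : ‖z‖ ≤ L) (hx : |x| ≤ X) :
    ‖sinKernel z x‖ ≤ X * Real.exp (√L * X) := by
  have hX : 0 ≤ X := (abs_nonneg _).trans hx
  have := (convex_Icc (-X) X).norm_image_sub_le_of_norm_hasDerivWithin_le
    (f := sinKernel z) (fun t _ => (hasDerivAt_sinKernel z t).hasDerivWithinAt)
    (C := Real.exp (√L * X)) (fun t ht => norm_cos_rho_le hz (abs_le.2 ht))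
    (x := 0) (y := x) ⟨by linarith, hX⟩ (abs_le.1 hx)
  rw [sinKernel_zero_right, sub_zero, sub_zero, Real.norm_eq_abs, mul_comm] at this
  exact this.trans (mul_le_mul_of_nonneg_right hx (Real.exp_nonneg _))

/-- On the mesh the kernel satisfies exactly the discrete recurrence with `2 cos (ρ h)` in place of
`2 - h² z`. The two coefficients differ by `O(h⁴)`, which gives the local error of the scheme. -/
theorem sinKernel_add_add_sub (z : ℂ) (x h : ℝ) :
    sinKernel z (x + h) + sinKernel z (x - h) =
      2 * Complex.cos (rho z * h) * sinKernel z x := by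
  unfold sinKernel; split_ifs with hz
  · simp [hz, rho_zero]; ring
  · push_cast
    rw [mul_add, mul_sub, Complex.sin_add, Complex.sin_sub]
    ring

theorem sinKernel_add_sub_sub (z : ℂ) (x h : ℝ) :
    sinKernel z (x + h) - sinKernel z (x - h) =
      2 * Complex.cos (rho z * x) * sinKernel z h := by
  unfold sinKernel; split_ifs with hz
  · simp [hz, rho_zero]; ring
  · push_cast
    rw [mul_add, mul_sub, Complex.sin_add, Complex.sin_sub]
    ring

theorem norm_rho_mul_le_one {z : ℂ} {L h : ℝ} (hz : ‖z‖ ≤ L) (hL : L * h ^ 2 ≤ 1) :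
    ‖rho z * h‖ ≤ 1 := by
  have : ‖rho z * h‖ ^ 2 ≤ 1 := by
    rw [norm_mul, mul_pow, norm_rho_sq, Complex.norm_real, Real.norm_eq_abs, sq_abs]
    exact (mul_le_mul_of_nonneg_right hz (sq_nonneg _)).trans hL
  exact (sq_le_one_iff₀ (norm_nonneg _)).1 this

theorem norm_two_cos_sub_le {z : ℂ} {L h : ℝ} (hz : ‖z‖ ≤ L) (hL : L * h ^ 2 ≤ 1) :
    ‖2 * Complex.cos (rho z * h) - (2 - (h : ℂ) ^ 2 * z)‖ ≤ L ^ 2 * h ^ 4 := by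
  have hb := Complex.cos_bound (norm_rho_mul_le_one hz hL)
  have e : 2 * Complex.cos (rho z * h) - (2 - (h : ℂ) ^ 2 * z) =
      2 * (Complex.cos (rho z * h) - (1 - (rho z * h) ^ 2 / 2)) := by
    rw [mul_pow, rho_sq]; ring
  have e2 : ‖rho z * h‖ ^ 4 ≤ L ^ 2 * h ^ 4 := by
    have : ‖rho z * h‖ ^ 4 = ‖z‖ ^ 2 * h ^ 4 := by
      rw [norm_mul, mul_pow, ← norm_rho_sq z, Complex.norm_real, Real.norm_eq_abs,
        Even.pow_abs (by decide)]
      ring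
    rw [this]
    gcongr
  have h0 : 0 ≤ ‖rho z * h‖ ^ 4 := by positivity
  rw [e, norm_mul, Complex.norm_two]
  linarith

theorem norm_sinKernel_sub_le {z : ℂ} {L h : ℝ} (hh : 0 ≤ h) (hz : ‖z‖ ≤ L)
    (hL : L * h ^ 2 ≤ 1) : ‖sinKernel z h - h‖ ≤ L * h ^ 3 := by
  by_cases hz0 : z = 0
  · have : 0 ≤ L := (norm_nonneg _).trans hz
    simp only [sinKernel, hz0, if_true, sub_self, norm_zero]
    positivity
  · have h1 := norm_rho_mul_le_one hz hL
    have hb := Complex.sin_bound h1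
    have hr := rho_ne_zero hz0
    have hr' : 0 < ‖rho z‖ := norm_pos_iff.2 hr
    have e : sinKernel z h - h = (Complex.sin (rho z * h) - rho z * h) / rho z := by
      simp only [sinKernel, hz0, if_false]
      field_simp
    have e2 : ‖Complex.sin (rho z * h) - rho z * h‖ ≤ ‖rho z * h‖ ^ 3 := by
      have e3 : Complex.sin (rho z * h) - rho z * h =
          (Complex.sin (rho z * h) - (rho z * h - (rho z * h) ^ 3 / 6)) -
            (rho z * h) ^ 3 / 6 := by ring
      rw [e3]
      refine (norm_sub_le _ _).trans ?_
      rw [norm_div, norm_pow]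
      have h5 : ‖rho z * h‖ ^ 5 ≤ ‖rho z * h‖ ^ 3 :=
        pow_le_pow_of_le_one (norm_nonneg _) h1 (by norm_num)
      have h6 : ‖(6 : ℂ)‖ = 6 := by norm_num
      have h0 : 0 ≤ ‖rho z * h‖ ^ 3 := by positivity
      rw [h6]
      linarith
    rw [e, norm_div, div_le_iff₀ hr']
    refine e2.trans ?_
    rw [norm_mul, Complex.norm_real, Real.norm_eq_abs, abs_of_nonneg hh]
    have : (‖rho z‖ * h) ^ 3 = ‖z‖ * h ^ 3 * ‖rho z‖ := by rw [← norm_rho_sq z]; ring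
    rw [this]
    gcongr

/-- Stability of the three-term recurrence of the discrete problem. -/
theorem recurrence_stability {e : ℕ → ℂ} {z : ℂ} {L A h X : ℝ} (hz : ‖z‖ ≤ L) (hA : 0 ≤ A)
    (hh : 0 < h) (hh1 : h ≤ 1) (h0 : e 0 = 0) (h1 : ‖e 1‖ ≤ A * h ^ 3)
    (hrec : ∀ j : ℕ, (j + 1 : ℕ) * h ≤ X →
      ‖e (j + 2) - ((2 - (h : ℂ) ^ 2 * z) * e (j + 1) - e j)‖ ≤ A * h ^ 4) (j : ℕ)
    (hj : j * h ≤ X) :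
    ‖e j‖ ≤ A * h ^ 2 * Real.exp ((2 + 2 * L) * (j * h)) ∧
      ‖e (j + 1) - e j‖ ≤ A * h ^ 3 * Real.exp ((2 + 2 * L) * (j * h)) := by
  have hL : 0 ≤ L := (norm_nonneg _).trans hz
  -- Errors and their first differences are carried together: about `1 / h` steps add up differences
  -- of size `h³` to an error of size `h²`. One step multiplies both bounds by at most `1 + (2 + 2
  -- L) h`, whence the exponential.
  induction j with
  | zero => simp [h0, h1]; positivity
  | succ j ih =>
    obtain ⟨ih1, ih2⟩ := ih (le_trans (by push_cast; nlinarith) hj)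
    set E := Real.exp ((2 + 2 * L) * (j * h)) with hE
    have hE1 : 1 ≤ E := Real.one_le_exp (by positivity)
    have hE2 : (1 + (2 + 2 * L) * h) * E ≤ Real.exp ((2 + 2 * L) * ((j + 1 : ℕ) * h)) := by
      rw [show (2 + 2 * L) * ((j + 1 : ℕ) * h) = (2 + 2 * L) * h + (2 + 2 * L) * (j * h) by
        push_cast; ring, Real.exp_add]
      exact mul_le_mul_of_nonneg_right (by linarith [Real.add_one_le_exp ((2 + 2 * L) * h)])
        (by positivity)
    have hu : ‖e (j + 1)‖ ≤ A * h ^ 2 * ((1 + h) * E) := by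
      have : e (j + 1) = e j + (e (j + 1) - e j) := by ring
      rw [this]
      refine (norm_add_le _ _).trans ((add_le_add ih1 ih2).trans (le_of_eq ?_))
      ring
    refine ⟨hu.trans ?_, ?_⟩
    · refine mul_le_mul_of_nonneg_left (le_trans ?_ hE2) (by positivity)
      refine mul_le_mul_of_nonneg_right ?_ (by positivity)
      nlinarith [mul_nonneg hL hh.le]
    · have e1 : e (j + 1 + 1) - e (j + 1) = (e (j + 2) - ((2 - (h : ℂ) ^ 2 * z) * e (j + 1) - e j)) +
          (e (j + 1) - e j) - (h : ℂ) ^ 2 * z * e (j + 1) := by ring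
      have e2 : ‖(h : ℂ) ^ 2 * z * e (j + 1)‖ ≤ h ^ 2 * L * (A * h ^ 2 * ((1 + h) * E)) := by
        rw [norm_mul, norm_mul, norm_pow, Complex.norm_real, Real.norm_eq_abs, sq_abs]
        gcongr
      have e3 := hrec j hj
      have e4 : A * h ^ 4 + A * h ^ 3 * E + h ^ 2 * L * (A * h ^ 2 * ((1 + h) * E)) ≤
          A * h ^ 3 * ((1 + (2 + 2 * L) * h) * E) := by
        have : h + E + h * L * ((1 + h) * E) ≤ (1 + (2 + 2 * L) * h) * E := by
          have t1 : h * L * ((1 + h) * E) ≤ h * L * (2 * E) := by gcongr; linarith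
          have t2 : h ≤ h * E := le_mul_of_one_le_right hh.le hE1
          have t3 : 0 ≤ h * E := by positivity
          linarith
        have := mul_le_mul_of_nonneg_left this (show 0 ≤ A * h ^ 3 by positivity)
        linarith
      rw [e1]
      refine (norm_sub_le _ _).trans ((add_le_add (norm_add_le _ _) le_rfl).trans ?_)
      refine le_trans ?_ (mul_le_mul_of_nonneg_left hE2 (by positivity))
      linarith

/-- The discrete analogue of `sin (ρ x) / ρ` is close to it, with its first differences. -/
theorem discS_sub_sinKernel_le {L X : ℝ} (hL : 0 ≤ L) (hX : 0 ≤ X) :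
    ∃ K : ℝ, 0 ≤ K ∧ ∀ z : ℂ, ‖z‖ ≤ L → ∀ h : ℝ, 0 < h → h ≤ 1 → L * h ^ 2 ≤ 1 →
      ∀ j : ℕ, j * h ≤ X →
        ‖(discS h j).eval z - sinKernel z (j * h)‖ ≤ K * h ^ 2 ∧
        ‖((discS h (j + 1)).eval z - sinKernel z ((j + 1 : ℕ) * h)) -
          ((discS h j).eval z - sinKernel z (j * h))‖ ≤ K * h ^ 3 := by
  -- The summand `L` covers the initial error, `s_1 = h` against `sin (ρ h) / ρ`; the other one is
  -- the local error `L² h⁴` times the bound of the kernel on `[0, X]`.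
  set A := L + X * Real.exp (√L * X) * L ^ 2 with hA
  have hA0 : 0 ≤ A := by positivity
  refine ⟨A * Real.exp ((2 + 2 * L) * X), by positivity, fun z hz h hh hh1 hLh j hj => ?_⟩
  have key := recurrence_stability (e := fun j => (discS h j).eval z - sinKernel z (j * h))
    (X := X) hz hA0 hh hh1 (by simp [discS, sinKernel_zero_right]) (by
      simp only [discS, Polynomial.eval_C, Nat.cast_one, one_mul]
      rw [norm_sub_rev]
      refine (norm_sinKernel_sub_le hh.le hz hLh).trans ?_
      gcongr
      rw [hA]
      exact le_add_of_nonneg_right (by positivity)) (by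
      intro j hj
      have e1 := sinKernel_add_add_sub z ((j + 1 : ℕ) * h) h
      rw [show ((j + 1 : ℕ) : ℝ) * h + h = (j + 2 : ℕ) * h by push_cast; ring,
        show ((j + 1 : ℕ) : ℝ) * h - h = j * h by push_cast; ring] at e1
      have e2 : (discS h (j + 2)).eval z = (2 - (h : ℂ) ^ 2 * z) * (discS h (j + 1)).eval z -
          (discS h j).eval z := by
        rw [discS_add_two]; simp
      have e3 : (discS h (j + 2)).eval z - sinKernel z ((j + 2 : ℕ) * h) -
          ((2 - (h : ℂ) ^ 2 * z) * ((discS h (j + 1)).eval z - sinKernel z ((j + 1 : ℕ) * h)) -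
            ((discS h j).eval z - sinKernel z (j * h))) =
          -((2 * Complex.cos (rho z * h) - (2 - (h : ℂ) ^ 2 * z)) *
            sinKernel z ((j + 1 : ℕ) * h)) := by
        linear_combination e2 - e1
      rw [e3, norm_neg, norm_mul]
      have b1 := norm_two_cos_sub_le hz hLh
      have b2 := norm_sinKernel_le (X := X) (x := (j + 1 : ℕ) * h) hz
        (by rwa [abs_of_nonneg (by positivity)])
      refine (mul_le_mul b1 b2 (norm_nonneg _) (by positivity)).trans ?_
      rw [show L ^ 2 * h ^ 4 * (X * Real.exp (√L * X)) = (X * Real.exp (√L * X) * L ^ 2) * h ^ 4 by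
        ring]
      gcongr
      rw [hA]
      exact le_add_of_nonneg_left hL) j hj
  have hexp : Real.exp ((2 + 2 * L) * (j * h)) ≤ Real.exp ((2 + 2 * L) * X) := by gcongr
  constructor
  · refine key.1.trans ?_
    rw [mul_right_comm]
    gcongr
  · refine key.2.trans ?_
    rw [mul_right_comm]
    gcongr

end Kernel

/-! ### Second-order approximation of the two factors -/

section Approximation

/-- The nontrivial factor of the characteristic function. -/
def charFactor (q : ℝ → ℂ) (z : ℂ) : ℂ :=
  2 * Complex.cos (rho z * ((Real.pi / 2 : ℝ) : ℂ)) +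
    ∫ t in (0 : ℝ)..(Real.pi / 2), (q t + q (Real.pi - t)) * sinKernel z t

theorem continuous_sinKernel (z : ℂ) : Continuous (sinKernel z) :=
  continuous_iff_continuousAt.2 fun x => (hasDerivAt_sinKernel z x).continuousAt

/-- By symmetry about the midpoint `S(0) = -S(π)`, so the determinant is `S(π) (C(0) + C(π))`. The
reflection `t ↦ π - t` folds the two integrals into one over `[0, π / 2]`. -/
theorem charFun_eq {q : ℝ → ℂ} (hq : ContinuousOn q (Set.Icc 0 Real.pi)) (z : ℂ) :
    charFun (Real.pi / 2) q z = sinKernel z (Real.pi / 2) * charFactor q z := by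
  have hpi := Real.pi_pos
  have e1 : solS (Real.pi / 2) z 0 = -sinKernel z (Real.pi / 2) := by
    rw [solS, zero_sub, sinKernel_neg]
  have e2 : solS (Real.pi / 2) z Real.pi = sinKernel z (Real.pi / 2) := by
    rw [solS, sub_half]
  have e3 : solC (Real.pi / 2) q z 0 = Complex.cos (rho z * ((Real.pi / 2 : ℝ) : ℂ)) +
      ∫ t in (0 : ℝ)..(Real.pi / 2), q t * sinKernel z t := by
    rw [solC, intervalIntegral.integral_symm, ← intervalIntegral.integral_neg]
    congr 1
    · rw [zero_sub, Complex.ofReal_neg, mul_neg, Complex.cos_neg]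
    · refine intervalIntegral.integral_congr fun t _ => ?_
      simp only [zero_sub, sinKernel_neg, mul_neg, neg_neg]
  have e4 : solC (Real.pi / 2) q z Real.pi = Complex.cos (rho z * ((Real.pi / 2 : ℝ) : ℂ)) +
      ∫ t in (0 : ℝ)..(Real.pi / 2), q (Real.pi - t) * sinKernel z t := by
    rw [solC, sub_half]
    congr 1
    have := intervalIntegral.integral_comp_sub_left
      (fun t => q t * sinKernel z (Real.pi - t)) Real.pi (a := 0) (b := Real.pi / 2)
    rw [sub_half, sub_zero] at this
    rw [← this]
    refine intervalIntegral.integral_congr fun t _ => ?_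
    simp only [sub_sub_cancel]
  have i1 : IntervalIntegrable (fun t => q t * sinKernel z t) MeasureTheory.volume 0
      (Real.pi / 2) := by
    refine ContinuousOn.intervalIntegrable ?_
    rw [Set.uIcc_of_le (by positivity)]
    exact (hq.mono (Set.Icc_subset_Icc le_rfl (by linarith))).mul
      (continuous_sinKernel z).continuousOn
  have i2 : IntervalIntegrable (fun t => q (Real.pi - t) * sinKernel z t) MeasureTheory.volume 0
      (Real.pi / 2) := by
    refine ContinuousOn.intervalIntegrable ?_
    rw [Set.uIcc_of_le (by positivity)]
    refine ContinuousOn.mul (hq.comp (by fun_prop) fun t ht => ?_)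
      (continuous_sinKernel z).continuousOn
    exact ⟨by linarith [ht.2], by linarith [ht.1]⟩
  rw [charFun, Matrix.det_fin_two_of, e1, e2, e3, e4, charFactor]
  simp only [add_mul]
  rw [intervalIntegral.integral_add i1 i2]
  ring

/-- The error of the trapezoidal rule for the integral in the characteristic function. -/
theorem trapezoid_charFactor {q : ℝ → ℂ} (hq : ContDiffOn ℝ 2 q (Set.Icc 0 Real.pi)) {L : ℝ}
    (hL : 0 ≤ L) :
    ∃ K : ℝ, 0 ≤ K ∧ ∀ z : ℂ, ‖z‖ ≤ L → ∀ m : ℕ, 0 < m →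
      ‖((Real.pi / 2 / m : ℝ) : ℂ) * (q (Real.pi / 2) * sinKernel z (Real.pi / 2) +
          ∑ k ∈ Finset.range (m - 1), (q ((k + 1 : ℕ) * (Real.pi / 2 / m)) +
            q (Real.pi - (k + 1 : ℕ) * (Real.pi / 2 / m))) *
              sinKernel z ((k + 1 : ℕ) * (Real.pi / 2 / m))) -
        ∫ t in (0 : ℝ)..(Real.pi / 2), (q t + q (Real.pi - t)) * sinKernel z t‖ ≤
      K * (Real.pi / 2 / m) ^ 2 := by
  have hpi := Real.pi_pos
  set I := Set.Icc 0 Real.pi with hI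
  have hu : UniqueDiffOn ℝ I := uniqueDiffOn_Icc hpi
  set q1 := derivWithin q I with hq1
  set q2 := derivWithin q1 I with hq2
  have c1 : ContDiffOn ℝ 1 q1 I := hq.derivWithin hu (by norm_num)
  have c2 : ContDiffOn ℝ 0 q2 I := c1.derivWithin hu (by norm_num)
  have d0 : ∀ t ∈ I, HasDerivWithinAt q (q1 t) I t := fun t ht =>
    (hq.differentiableOn (by norm_num) t ht).hasDerivWithinAt
  have d1 : ∀ t ∈ I, HasDerivWithinAt q1 (q2 t) I t := fun t ht =>
    (c1.differentiableOn (by norm_num) t ht).hasDerivWithinAt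
  obtain ⟨C0, hC0⟩ := isCompact_Icc.exists_bound_of_continuousOn hq.continuousOn
  obtain ⟨C1, hC1⟩ := isCompact_Icc.exists_bound_of_continuousOn c1.continuousOn
  obtain ⟨C2, hC2⟩ := isCompact_Icc.exists_bound_of_continuousOn c2.continuousOn
  have hC0' : 0 ≤ C0 := (norm_nonneg _).trans (hC0 0 ⟨le_rfl, hpi.le⟩)
  have hC1' : 0 ≤ C1 := (norm_nonneg _).trans (hC1 0 ⟨le_rfl, hpi.le⟩)
  have hC2' : 0 ≤ C2 := (norm_nonneg _).trans (hC2 0 ⟨le_rfl, hpi.le⟩)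
  set J := Set.Icc 0 (Real.pi / 2) with hJ
  have hJI : J ⊆ I := Set.Icc_subset_Icc le_rfl (by linarith)
  have hrefl : Set.MapsTo (fun t => Real.pi - t) J I := fun t ht =>
    ⟨by linarith [ht.2], by linarith [ht.1]⟩
  have dr : ∀ t, HasDerivWithinAt (fun t => Real.pi - t) (-1 : ℝ) J t := fun t => by
    simpa using ((hasDerivAt_id t).const_sub Real.pi).hasDerivWithinAt
  set B := Real.pi * Real.exp (√L * Real.pi) with hB
  set E := Real.exp (√L * Real.pi) with hE
  have hB0 : 0 ≤ B := by positivity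
  have hE0 : 0 ≤ E := by positivity
  -- With `Q(t) = q(t) + q(π - t)` the factor in parentheses bounds `(Q s)'' = Q'' s + 2 Q' s' + Q
  -- s''`, where `s'' = -z s`.
  refine ⟨Real.pi / 2 * (2 * C2 * B + 4 * C1 * E + 2 * C0 * (L * B)), by positivity,
    fun z hz m hm => ?_⟩
  have dQ : ∀ t ∈ J, HasDerivWithinAt (fun t => q t + q (Real.pi - t))
      (q1 t - q1 (Real.pi - t)) J t := fun t ht => by
    have a1 := (d0 t (hJI ht)).mono hJI
    have a2 := (d0 _ (hrefl ht)).scomp t (dr t) hrefl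
    simpa [sub_eq_add_neg, Function.comp_def] using a1.fun_add a2
  have dQ1 : ∀ t ∈ J, HasDerivWithinAt (fun t => q1 t - q1 (Real.pi - t))
      (q2 t + q2 (Real.pi - t)) J t := fun t ht => by
    have a1 := (d1 t (hJI ht)).mono hJI
    have a2 := (d1 _ (hrefl ht)).scomp t (dr t) hrefl
    simpa [sub_eq_add_neg, Function.comp_def] using a1.fun_sub a2
  have ds : ∀ t : ℝ, HasDerivWithinAt (sinKernel z) (Complex.cos (rho z * t)) J t := fun t =>
    (hasDerivAt_sinKernel z t).hasDerivWithinAt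
  have dc : ∀ t : ℝ, HasDerivWithinAt (fun t : ℝ => Complex.cos (rho z * t)) (-(z * sinKernel z t)) J t :=
    fun t => (hasDerivAt_cos_rho z t).hasDerivWithinAt
  have key := norm_trapezoid_sub_integral_le (b := Real.pi / 2) (by positivity)
    (ζ := 2 * C2 * B + 4 * C1 * E + 2 * C0 * (L * B))
    (fun t ht => (dQ t ht).mul (ds t))
    (fun t ht => ((dQ1 t ht).mul (ds t)).add ((dQ t ht).mul (dc t))) (fun t ht => by
      have hz0 : ‖q t + q (Real.pi - t)‖ ≤ 2 * C0 := (norm_add_le _ _).trans (by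
        linarith [hC0 t (hJI ht), hC0 _ (hrefl ht)])
      have hz1 : ‖q1 t - q1 (Real.pi - t)‖ ≤ 2 * C1 := (norm_sub_le _ _).trans (by
        linarith [hC1 t (hJI ht), hC1 _ (hrefl ht)])
      have hz2 : ‖q2 t + q2 (Real.pi - t)‖ ≤ 2 * C2 := (norm_add_le _ _).trans (by
        linarith [hC2 t (hJI ht), hC2 _ (hrefl ht)])
      have ht' : |t| ≤ Real.pi := by
        rw [abs_of_nonneg ht.1]; linarith [ht.2]
      have hs := norm_sinKernel_le hz ht'
      have hc := norm_cos_rho_le hz ht'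
      have hzs : ‖-(z * sinKernel z t)‖ ≤ L * B := by
        rw [norm_neg, norm_mul]
        exact mul_le_mul hz hs (norm_nonneg _) hL
      have m1 := mul_le_mul hz2 hs (norm_nonneg _) (by positivity)
      have m2 := mul_le_mul hz1 hc (norm_nonneg _) (by positivity)
      have m3 := mul_le_mul hz0 hzs (norm_nonneg _) (by positivity)
      rw [← norm_mul] at m1 m2 m3
      refine (norm_add_le _ _).trans ((add_le_add (norm_add_le _ _) (norm_add_le _ _)).trans ?_)
      linarith) hm
  refine (le_of_eq ?_).trans (key.trans (le_of_eq ?_))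
  · congr 3
    -- The endpoint `0` drops out since the kernel vanishes there; at `π / 2` the half weight
    -- cancels the doubling of `q`.
    simp only [Pi.mul_apply, sinKernel_zero_right, mul_zero, zero_add, sub_half]
    congr 1
    ring
  · field_simp

theorem step_eq {m : ℕ} (hm : 1 ≤ m) : step (2 * m - 1) = Real.pi / 2 / m := by
  have : ((2 * m - 1 : ℕ) : ℝ) + 1 = 2 * m := by
    have : (2 * m - 1) + 1 = 2 * m := by omega
    exact_mod_cast this
  rw [step, this, div_div]

/-- The values of `q` at the mesh points. -/
def nodes (q : ℝ → ℂ) (h : ℝ) (j : ℕ) : ℂ := q (j * h)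

/-- The factors of the discrete characteristic function approximate those of the continuous one
with the second order of accuracy, locally uniformly in the spectral parameter. -/
theorem discrete_factors_approx {q : ℝ → ℂ} (hq : ContDiffOn ℝ 2 q (Set.Icc 0 Real.pi)) {L : ℝ}
    (hL : 0 ≤ L) :
    ∃ K : ℝ, 0 ≤ K ∧ ∀ h : ℝ, ∀ m : ℕ, 1 ≤ m → h = Real.pi / 2 / m → h ≤ 1 → L * h ^ 2 ≤ 1 →
      ∀ z : ℂ, ‖z‖ ≤ L →
        ‖(discS h m).eval z - sinKernel z (Real.pi / 2)‖ ≤ K * h ^ 2 ∧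
        ‖(discF h m (nodes q h)).eval z / h - charFactor q z‖ ≤ K * h ^ 2 := by
  have hpi := Real.pi_pos
  obtain ⟨K1, hK1, H1⟩ := discS_sub_sinKernel_le hL hpi.le
  obtain ⟨K2, hK2, H2⟩ := trapezoid_charFactor hq hL
  obtain ⟨C0, hC0⟩ := isCompact_Icc.exists_bound_of_continuousOn hq.continuousOn
  have hC0' : 0 ≤ C0 := (norm_nonneg _).trans (hC0 0 ⟨le_rfl, hpi.le⟩)
  set E := Real.exp (√L * Real.pi) with hE
  -- `K1` serves the first estimate. In the second, `2 K1` and `2 E L` come from the central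
  -- difference, the term with `π / 2 = m h` from replacing `s_j` by the kernel in the sum, and `K2`
  -- from the trapezoidal rule.
  refine ⟨K1 + (2 * K1 + 2 * E * L + Real.pi / 2 * (2 * C0 * K1) + K2), by positivity, ?_⟩
  intro h m hm hh hh1 hLh z hz
  have hm' : (0 : ℝ) < m := by exact_mod_cast hm
  have hpos : 0 < h := by rw [hh]; positivity
  have hc : (h : ℂ) ≠ 0 := by exact_mod_cast hpos.ne'
  have hmh : m * h = Real.pi / 2 := by rw [hh]; field_simp
  have hjle : ∀ j : ℕ, j ≤ m → (j : ℝ) * h ≤ Real.pi := fun j hj => by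
    have : (j : ℝ) * h ≤ m * h := by gcongr
    linarith
  obtain ⟨a1, a2⟩ := H1 z hz h hpos hh1 hLh m (hjle m le_rfl)
  rw [hmh] at a1 a2
  have hrest : 0 ≤ (2 * K1 + 2 * E * L + Real.pi / 2 * (2 * C0 * K1) + K2) * h ^ 2 := by positivity
  refine ⟨by linarith, ?_⟩
  obtain ⟨n, rfl⟩ : ∃ n, m = n + 1 := ⟨m - 1, by omega⟩
  obtain ⟨-, a3⟩ := H1 z hz h hpos hh1 hLh n (hjle n (by omega))
  rw [hmh] at a3
  rw [show ((n + 1 + 1 : ℕ) : ℝ) * h = Real.pi / 2 + h by rw [← hmh]; push_cast; ring] at a2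
  rw [show ((n : ℕ) : ℝ) * h = Real.pi / 2 - h by rw [← hmh]; push_cast; ring] at a3
  have hdiff := sinKernel_add_sub_sub z (Real.pi / 2) h
  -- Division by `h` costs one order, so the `O(h³)` estimate of first differences is essential
  -- here.
  have b1 : ‖((discS h (n + 1 + 1)).eval z - (discS h n).eval z) / h -
      2 * Complex.cos (rho z * ((Real.pi / 2 : ℝ) : ℂ))‖ ≤ (2 * K1 + 2 * E * L) * h ^ 2 := by
    have e : ((discS h (n + 1 + 1)).eval z - (discS h n).eval z) / h -
        2 * Complex.cos (rho z * ((Real.pi / 2 : ℝ) : ℂ)) =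
        ((((discS h (n + 1 + 1)).eval z - sinKernel z (Real.pi / 2 + h)) -
          ((discS h (n + 1)).eval z - sinKernel z (Real.pi / 2))) +
        (((discS h (n + 1)).eval z - sinKernel z (Real.pi / 2)) -
          ((discS h n).eval z - sinKernel z (Real.pi / 2 - h))) +
        2 * Complex.cos (rho z * ((Real.pi / 2 : ℝ) : ℂ)) * (sinKernel z h - h)) / h := by
      rw [eq_div_iff hc, sub_mul, div_mul_cancel₀ _ hc]
      linear_combination hdiff
    have f1 : ‖2 * Complex.cos (rho z * ((Real.pi / 2 : ℝ) : ℂ)) * (sinKernel z h - h)‖ ≤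
        2 * E * (L * h ^ 3) := by
      rw [norm_mul, norm_mul, Complex.norm_two]
      have g1 := norm_cos_rho_le (X := Real.pi) (x := Real.pi / 2) hz
        (by rw [abs_of_pos (by positivity)]; linarith)
      have g2 := norm_sinKernel_sub_le hpos.le hz hLh
      gcongr
    rw [e, norm_div, Complex.norm_real, Real.norm_eq_abs, abs_of_pos hpos, div_le_iff₀ hpos]
    refine (norm_add_le _ _).trans ((add_le_add (norm_add_le _ _) f1).trans ?_)
    linarith
  have b2 : ‖(h : ℂ) * ((∑ i ∈ Finset.range n, (discS h (i + 1)).eval z *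
        (nodes q h (i + 1) + nodes q h (2 * (n + 1) - (i + 1)))) +
        (discS h (n + 1)).eval z * nodes q h (n + 1)) -
      (h : ℂ) * (q (Real.pi / 2) * sinKernel z (Real.pi / 2) +
          ∑ k ∈ Finset.range n, (q ((k + 1 : ℕ) * h) +
            q (Real.pi - (k + 1 : ℕ) * h)) * sinKernel z ((k + 1 : ℕ) * h))‖ ≤
      Real.pi / 2 * (2 * C0 * K1) * h ^ 2 := by
    have e : (h : ℂ) * ((∑ i ∈ Finset.range n, (discS h (i + 1)).eval z *
          (nodes q h (i + 1) + nodes q h (2 * (n + 1) - (i + 1)))) +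
          (discS h (n + 1)).eval z * nodes q h (n + 1)) -
        (h : ℂ) * (q (Real.pi / 2) * sinKernel z (Real.pi / 2) +
          ∑ k ∈ Finset.range n, (q ((k + 1 : ℕ) * h) +
            q (Real.pi - (k + 1 : ℕ) * h)) * sinKernel z ((k + 1 : ℕ) * h)) =
        (h : ℂ) * ((∑ k ∈ Finset.range n, (q ((k + 1 : ℕ) * h) + q (Real.pi - (k + 1 : ℕ) * h)) *
          ((discS h (k + 1)).eval z - sinKernel z ((k + 1 : ℕ) * h))) +
          q (Real.pi / 2) * ((discS h (n + 1)).eval z - sinKernel z (Real.pi / 2))) := by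
      have e1 : ∑ i ∈ Finset.range n, (discS h (i + 1)).eval z *
          (nodes q h (i + 1) + nodes q h (2 * (n + 1) - (i + 1))) =
          ∑ k ∈ Finset.range n, (q ((k + 1 : ℕ) * h) + q (Real.pi - (k + 1 : ℕ) * h)) *
            (discS h (k + 1)).eval z := by
        refine Finset.sum_congr rfl fun i hi => ?_
        rw [Finset.mem_range] at hi
        have : ((2 * (n + 1) - (i + 1) : ℕ) : ℝ) * h = Real.pi - (i + 1 : ℕ) * h := by
          rw [Nat.cast_sub (by omega), sub_mul]
          push_cast at hmh ⊢
          linarith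
        rw [nodes, nodes, this, mul_comm]
      have e2 : nodes q h (n + 1) = q (Real.pi / 2) := by rw [nodes, hmh]
      simp only [e1, e2, mul_sub, Finset.sum_sub_distrib]
      ring
    have hterm : ∀ k ∈ Finset.range n,
        ‖(q ((k + 1 : ℕ) * h) + q (Real.pi - (k + 1 : ℕ) * h)) *
          ((discS h (k + 1)).eval z - sinKernel z ((k + 1 : ℕ) * h))‖ ≤ 2 * C0 * (K1 * h ^ 2) := by
      intro k hk
      rw [Finset.mem_range] at hk
      have hle := hjle (k + 1) (by omega)
      have hnn : 0 ≤ ((k + 1 : ℕ) : ℝ) * h := by positivity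
      have g1 := hC0 _ ⟨hnn, hle⟩
      have g2 := hC0 (Real.pi - (k + 1 : ℕ) * h) ⟨by linarith, by linarith⟩
      have g3 := (H1 z hz h hpos hh1 hLh (k + 1) hle).1
      rw [norm_mul]
      refine mul_le_mul ((norm_add_le _ _).trans (by linarith)) g3 (norm_nonneg _) (by positivity)
    have hlast : ‖q (Real.pi / 2) * ((discS h (n + 1)).eval z - sinKernel z (Real.pi / 2))‖ ≤
        2 * C0 * (K1 * h ^ 2) := by
      rw [norm_mul]
      have g1 := hC0 (Real.pi / 2) ⟨by positivity, by linarith⟩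
      refine mul_le_mul (by linarith) a1 (norm_nonneg _) (by positivity)
    have hsum := Finset.sum_le_sum hterm
    rw [Finset.sum_const, Finset.card_range, nsmul_eq_mul] at hsum
    rw [e, norm_mul, Complex.norm_real, Real.norm_eq_abs, abs_of_pos hpos]
    have := (norm_add_le _ _).trans (add_le_add ((norm_sum_le _ _).trans hsum) hlast)
    refine (mul_le_mul_of_nonneg_left this hpos.le).trans (le_of_eq ?_)
    rw [← hmh]
    push_cast
    ring
  have b3 := H2 z hz (n + 1) (by omega)
  rw [← hh, Nat.add_sub_cancel] at b3
  have hF : (discF h (n + 1) (nodes q h)).eval z / h =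
      ((discS h (n + 1 + 1)).eval z - (discS h n).eval z) / h +
      (h : ℂ) * ((∑ i ∈ Finset.range n, (discS h (i + 1)).eval z *
        (nodes q h (i + 1) + nodes q h (2 * (n + 1) - (i + 1)))) +
        (discS h (n + 1)).eval z * nodes q h (n + 1)) := by
    rw [discF, Nat.add_sub_cancel]
    simp only [Polynomial.eval_add, Polynomial.eval_sub, Polynomial.eval_mul, Polynomial.eval_C,
      Polynomial.eval_finsetSum]
    field_simp
  have hfin : (discF h (n + 1) (nodes q h)).eval z / h - charFactor q z =
      (((discS h (n + 1 + 1)).eval z - (discS h n).eval z) / h -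
        2 * Complex.cos (rho z * ((Real.pi / 2 : ℝ) : ℂ))) +
      ((h : ℂ) * ((∑ i ∈ Finset.range n, (discS h (i + 1)).eval z *
        (nodes q h (i + 1) + nodes q h (2 * (n + 1) - (i + 1)))) +
        (discS h (n + 1)).eval z * nodes q h (n + 1)) -
      (h : ℂ) * (q (Real.pi / 2) * sinKernel z (Real.pi / 2) +
          ∑ k ∈ Finset.range n, (q ((k + 1 : ℕ) * h) +
            q (Real.pi - (k + 1 : ℕ) * h)) * sinKernel z ((k + 1 : ℕ) * h))) +
      ((h : ℂ) * (q (Real.pi / 2) * sinKernel z (Real.pi / 2) +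
          ∑ k ∈ Finset.range n, (q ((k + 1 : ℕ) * h) +
            q (Real.pi - (k + 1 : ℕ) * h)) * sinKernel z ((k + 1 : ℕ) * h)) -
        ∫ t in (0 : ℝ)..(Real.pi / 2), (q t + q (Real.pi - t)) * sinKernel z t) := by
    rw [hF, charFactor]
    ring
  rw [hfin]
  refine (norm_add_le _ _).trans ((add_le_add ((norm_add_le _ _).trans (add_le_add b1 b2))
    b3).trans ?_)
  have : 0 ≤ K1 * h ^ 2 := by positivity
  linarith

end Approximation

/-! ### Discrete eigenvalues near simple zeros -/

section Numbering
open Polynomial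

theorem step_pos (l : ℕ) : 0 < step l := by
  unfold step; positivity

theorem tendsto_step : Tendsto (fun m : ℕ => step (2 * m - 1)) atTop (𝓝 0) := by
  have h : Tendsto (fun m : ℕ => Real.pi / 2 / (m : ℝ)) atTop (𝓝 0) :=
    tendsto_const_nhds.div_atTop tendsto_natCast_atTop_atTop
  refine h.congr' ?_
  filter_upwards [eventually_ge_atTop 1] with m hm
  rw [step_eq hm]

theorem eventually_mul_step_sq_lt (K : ℝ) {δ : ℝ} (hδ : 0 < δ) :
    ∀ᶠ m : ℕ in atTop, K * step (2 * m - 1) ^ 2 < δ := by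
  have h : Tendsto (fun m : ℕ => K * step (2 * m - 1) ^ 2) atTop (𝓝 (K * 0 ^ 2)) :=
    (tendsto_step.pow 2).const_mul K
  rw [zero_pow two_ne_zero, mul_zero] at h
  exact h.eventually_lt_const hδ

/-- The normalized characteristic polynomial of the discrete problem. -/
def discChar (q : ℝ → ℂ) (m : ℕ) : ℂ[X] :=
  discS (step (2 * m - 1)) m * discF (step (2 * m - 1)) m (nodes q (step (2 * m - 1))) *
    C ((step (2 * m - 1) : ℂ)⁻¹)

theorem mem_roots_charpoly_iff (q : ℝ → ℂ) {m : ℕ} (hm : 1 ≤ m) (z : ℂ) :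
    z ∈ (diffMatrix (2 * m - 1) m q).charpoly.roots ↔ (discChar q m).eval z = 0 := by
  have hs : ((step (2 * m - 1) : ℝ) : ℂ) ≠ 0 := by exact_mod_cast (step_pos _).ne'
  have h := congrArg (eval z) (charpoly_diffMatrix (l := 2 * m - 1) hm (by omega) q)
  simp only [eval_mul, eval_pow, eval_C, eval_neg] at h
  rw [mem_roots (Matrix.charpoly_monic _).ne_zero, IsRoot.def, discChar]
  simp only [eval_mul, eval_C, mul_eq_zero, inv_eq_zero, hs, or_false]
  have h2 : ((step (2 * m - 1) : ℂ) ^ 2) ^ (2 * m - 1 + 1) ≠ 0 := pow_ne_zero _ (pow_ne_zero _ hs)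
  constructor
  · intro h0
    rw [h0, mul_zero, zero_eq_neg, mul_comm] at h
    exact mul_eq_zero.1 h
  · intro h0
    have h1 := mul_eq_zero.2 h0
    rw [mul_comm] at h1
    unfold nodes at h1
    rw [h1, neg_zero] at h
    exact (mul_eq_zero.1 h).resolve_left h2

theorem card_roots_charpoly (q : ℝ → ℂ) (l m : ℕ) :
    Multiset.card (diffMatrix l m q).charpoly.roots = l := by
  rw [← (IsAlgClosed.splits _).natDegree_eq_card_roots, Matrix.charpoly_natDegree_eq_dim,
    Fintype.card_fin]

theorem norm_charFactor_le {q : ℝ → ℂ} (hq : ContinuousOn q (Set.Icc 0 Real.pi)) (L : ℝ) :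
    ∃ K : ℝ, 0 ≤ K ∧ ∀ z : ℂ, ‖z‖ ≤ L → ‖charFactor q z‖ ≤ K := by
  have hpi := Real.pi_pos
  obtain ⟨C0, hC0⟩ := isCompact_Icc.exists_bound_of_continuousOn hq
  have hC0' : 0 ≤ C0 := (norm_nonneg _).trans (hC0 0 ⟨le_rfl, hpi.le⟩)
  refine ⟨2 * Real.exp (√L * Real.pi) +
    (2 * C0) * (Real.pi * Real.exp (√L * Real.pi)) * |Real.pi / 2 - 0|, by positivity,
    fun z hz => ?_⟩
  refine (norm_add_le _ _).trans (add_le_add ?_ ?_)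
  · rw [norm_mul, Complex.norm_two]
    have := norm_cos_rho_le (X := Real.pi) (x := Real.pi / 2) hz
      (by rw [abs_of_pos (by positivity)]; linarith)
    linarith
  · refine intervalIntegral.norm_integral_le_of_norm_le_const fun t ht => ?_
    rw [Set.uIoc_of_le (by positivity)] at ht
    have h1 := hC0 t ⟨ht.1.le, by linarith [ht.2]⟩
    have h2 := hC0 (Real.pi - t) ⟨by linarith [ht.2], by linarith [ht.1]⟩
    have h3 := norm_sinKernel_le (X := Real.pi) (x := t) hz
      (by rw [abs_of_pos ht.1]; linarith [ht.2])
    rw [norm_mul]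
    exact mul_le_mul ((norm_add_le _ _).trans (by linarith)) h3 (norm_nonneg _) (by positivity)

/-- The characteristic polynomials of the discrete problems approximate the characteristic
function with the second order of accuracy, locally uniformly. -/
theorem discChar_approx {q : ℝ → ℂ} (hq : ContDiffOn ℝ 2 q (Set.Icc 0 Real.pi)) {L : ℝ}
    (hL : 0 ≤ L) :
    ∃ K : ℝ, 0 ≤ K ∧ ∀ᶠ m : ℕ in atTop, ∀ z : ℂ, ‖z‖ ≤ L →
      ‖(discS (step (2 * m - 1)) m).eval z - sinKernel z (Real.pi / 2)‖ ≤
        K * step (2 * m - 1) ^ 2 ∧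
      ‖(discChar q m).eval z - charFun (Real.pi / 2) q z‖ ≤ K * step (2 * m - 1) ^ 2 := by
  have hpi := Real.pi_pos
  obtain ⟨K, hK, H⟩ := discrete_factors_approx hq hL
  obtain ⟨F, hF, HF⟩ := norm_charFactor_le hq.continuousOn L
  set B := Real.pi * Real.exp (√L * Real.pi) with hB
  have hB0 : 0 ≤ B := by positivity
  refine ⟨K + (K * (F + K) + B * K), by positivity, ?_⟩
  filter_upwards [eventually_ge_atTop 1, tendsto_step.eventually_lt_const one_pos,
    eventually_mul_step_sq_lt L one_pos] with m hm h1 h2 z hz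
  have hh := step_eq hm
  have hpos := step_pos (2 * m - 1)
  set h := step (2 * m - 1) with hstep
  obtain ⟨a1, a2⟩ := H h m hm hh h1.le h2.le z hz
  have hsq : h ^ 2 ≤ 1 := pow_le_one₀ hpos.le h1.le
  have hKh : 0 ≤ K * h ^ 2 := by positivity
  have hKh1 : K * h ^ 2 ≤ K := mul_le_of_le_one_right hK hsq
  constructor
  · have : 0 ≤ (K * (F + K) + B * K) * h ^ 2 := by positivity
    linarith
  -- The error of a product: the kernel's error times the approximate second factor, plus the kernel
  -- times the second factor's error.
  · have e : (discChar q m).eval z - charFun (Real.pi / 2) q z =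
        ((discS h m).eval z - sinKernel z (Real.pi / 2)) *
          (charFactor q z + ((discF h m (nodes q h)).eval z / h - charFactor q z)) +
        sinKernel z (Real.pi / 2) * ((discF h m (nodes q h)).eval z / h - charFactor q z) := by
      rw [charFun_eq hq.continuousOn, discChar]
      simp only [eval_mul, eval_C, ← hstep]
      ring
    have hs := norm_sinKernel_le (X := Real.pi) (x := Real.pi / 2) hz
      (by rw [abs_of_pos (by positivity)]; linarith)
    have b1 : ‖charFactor q z + ((discF h m (nodes q h)).eval z / h - charFactor q z)‖ ≤ F + K :=
      (norm_add_le _ _).trans (add_le_add (HF z hz) (a2.trans hKh1))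
    have b2 := mul_le_mul a1 b1 (norm_nonneg _) hKh
    have b3 := mul_le_mul hs a2 (norm_nonneg _) hB0
    rw [← norm_mul] at b2 b3
    rw [e]
    refine (norm_add_le _ _).trans ((add_le_add b2 b3).trans ?_)
    linarith

/-- The branch of `rho` is discontinuous, so continuity in `z` is obtained from the locally uniform
approximation by the polynomials `s_m`. These do not involve the potential, and `q = 0` is taken. -/
theorem continuous_sinKernel_left : Continuous fun z : ℂ => sinKernel z (Real.pi / 2) := by
  refine continuous_iff_continuousAt.2 fun z₀ => ?_
  obtain ⟨K, hK, H⟩ := discChar_approx (q := 0) contDiffOn_const (L := ‖z₀‖ + 1) (by positivity)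
  have hu : TendstoUniformlyOn (fun (m : ℕ) z => (discS (step (2 * m - 1)) m).eval z)
      (fun z => sinKernel z (Real.pi / 2)) atTop (Metric.closedBall 0 (‖z₀‖ + 1)) := by
    rw [Metric.tendstoUniformlyOn_iff]
    intro ε hε
    filter_upwards [H, eventually_mul_step_sq_lt K hε] with m hm hm2 z hz
    rw [dist_eq_norm, norm_sub_rev]
    exact ((hm z (by simpa using hz)).1).trans_lt hm2
  refine (hu.continuousOn (Eventually.of_forall fun m =>
    (Polynomial.continuous _).continuousOn).frequently).continuousAt ?_
  exact Metric.closedBall_mem_nhds_of_mem (by simp)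

theorem eq_sq_of_sinKernel_eq_zero {z : ℂ} (hz : sinKernel z (Real.pi / 2) = 0) :
    ∃ k : ℕ, 1 ≤ k ∧ z = (2 * (k : ℂ)) ^ 2 := by
  have hpi : (Real.pi : ℂ) ≠ 0 := by exact_mod_cast Real.pi_ne_zero
  by_cases h0 : z = 0
  · simp [sinKernel, h0, hpi] at hz
  · have h1 := rho_mul_sinKernel z (Real.pi / 2)
    rw [hz, mul_zero, eq_comm, Complex.sin_eq_zero_iff] at h1
    obtain ⟨k, hk⟩ := h1
    have hr : rho z = 2 * k := by
      push_cast at hk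
      field_simp at hk
      linear_combination hk
    have hz2 : z = (2 * (k.natAbs : ℂ)) ^ 2 := by
      rw [← rho_sq z, hr, mul_pow, mul_pow]
      congr 1
      have h := congrArg (fun t : ℤ => (t : ℂ)) (Int.natAbs_sq k)
      simp only [Int.cast_pow, Int.cast_natCast] at h
      exact h.symm
    refine ⟨k.natAbs, ?_, hz2⟩
    rw [Nat.one_le_iff_ne_zero]
    intro hk0
    rw [hk0] at hz2
    simp [h0] at hz2

/-- A lower bound of a function near a simple zero. -/
theorem exists_lower_bound_of_analyticOrderAt_eq_one {f : ℂ → ℂ} {w : ℂ}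
    (hf : analyticOrderAt f w = 1) :
    f w = 0 ∧ ∃ c > 0, ∃ r > 0, ∀ z, ‖z - w‖ ≤ r → c * ‖z - w‖ ≤ ‖f z‖ := by
  -- A function that is not analytic at `w` has order zero by convention, so order one already
  -- implies analyticity.
  have hA : AnalyticAt ℂ f w := by
    by_contra h
    rw [analyticOrderAt_of_not_analyticAt h] at hf
    exact zero_ne_one hf
  obtain ⟨g, hg, hg0, he⟩ := (hA.analyticOrderAt_eq_natCast (n := 1)).1 (by exact_mod_cast hf)
  refine ⟨by simpa using he.self_of_nhds, ‖g w‖ / 2, by positivity, ?_⟩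
  have hlt : ‖g w‖ / 2 < ‖g w‖ := half_lt_self (norm_pos_iff.2 hg0)
  have hev := he.and (hg.continuousAt.norm.eventually_const_lt hlt)
  obtain ⟨r, hr, H⟩ := Metric.nhds_basis_closedBall.eventually_iff.1 hev
  refine ⟨r, hr, fun z hz => ?_⟩
  obtain ⟨h1, h2⟩ := H (x := z) (by simpa [dist_eq_norm] using hz)
  rw [h1, pow_one, smul_eq_mul, norm_mul, mul_comm]
  exact mul_le_mul_of_nonneg_left h2.le (norm_nonneg _)

/-- Discrete eigenvalues that stay near a simple eigenvalue approximate it with the second order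
of accuracy. -/
theorem roots_near_simple_zero {q : ℝ → ℂ} (hq : ContDiffOn ℝ 2 q (Set.Icc 0 Real.pi)) {w : ℂ}
    (hw : analyticOrderAt (charFun (Real.pi / 2) q) w = 1) :
    ∃ K : ℝ, ∃ r > 0, ∀ᶠ m : ℕ in atTop, ∀ z ∈ (diffMatrix (2 * m - 1) m q).charpoly.roots,
      ‖z - w‖ ≤ r → ‖z - w‖ ≤ K * step (2 * m - 1) ^ 2 := by
  obtain ⟨-, c, hc, r, hr, H⟩ := exists_lower_bound_of_analyticOrderAt_eq_one hw
  obtain ⟨K, hK, HK⟩ := discChar_approx hq (L := ‖w‖ + r) (by positivity)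
  refine ⟨K / c, r, hr, ?_⟩
  filter_upwards [HK, eventually_ge_atTop 1] with m hm hm1 z hz hzr
  have h1 := (hm z (by
    have := norm_add_le w (z - w)
    rw [add_sub_cancel] at this
    linarith)).2
  rw [(mem_roots_charpoly_iff q hm1 z).1 hz, zero_sub, norm_neg] at h1
  rw [div_mul_eq_mul_div, le_div_iff₀ hc, mul_comm]
  exact (H z hzr).trans h1

/-- Near a simple nondegenerate eigenvalue there are nondegenerate discrete eigenvalues. -/
theorem exists_root_near_simple_zero {q : ℝ → ℂ} (hq : ContDiffOn ℝ 2 q (Set.Icc 0 Real.pi))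
    {w : ℂ} (hw : analyticOrderAt (charFun (Real.pi / 2) q) w = 1)
    (hs : sinKernel w (Real.pi / 2) ≠ 0) :
    ∃ K : ℝ, ∃ r > 0, (∀ z, ‖z - w‖ ≤ r → charFun (Real.pi / 2) q z = 0 → z = w) ∧
      ∀ᶠ m : ℕ in atTop, ∃ z ∈ (diffMatrix (2 * m - 1) m q).charpoly.roots,
        (discS (step (2 * m - 1)) m).eval z ≠ 0 ∧ ‖z - w‖ ≤ K * step (2 * m - 1) ^ 2 := by
  obtain ⟨hw0, c, hc, r₁, hr₁, H⟩ := exists_lower_bound_of_analyticOrderAt_eq_one hw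
  obtain ⟨K₀, r₂, hr₂, HK₀⟩ := roots_near_simple_zero hq hw
  have hδ : 0 < ‖sinKernel w (Real.pi / 2)‖ / 2 := by positivity
  obtain ⟨r₃, hr₃, Hs⟩ := Metric.nhds_basis_closedBall.eventually_iff.1
    (continuous_sinKernel_left.continuousAt.norm.eventually_const_lt
      (half_lt_self (norm_pos_iff.2 hs)))
  set r := min r₁ (min r₂ r₃) with hrdef
  have hr : 0 < r := lt_min hr₁ (lt_min hr₂ hr₃)
  have hrr₁ : r ≤ r₁ := min_le_left _ _
  have hrr₂ : r ≤ r₂ := (min_le_right _ _).trans (min_le_left _ _)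
  have hrr₃ : r ≤ r₃ := (min_le_right _ _).trans (min_le_right _ _)
  obtain ⟨K, hK, HK⟩ := discChar_approx hq (L := ‖w‖ + r) (by positivity)
  have hnorm : ∀ z, ‖z - w‖ ≤ r → ‖z‖ ≤ ‖w‖ + r := fun z hz => by
    have := norm_add_le w (z - w)
    rw [add_sub_cancel] at this
    linarith
  refine ⟨K₀, r, hr, fun z hz hz0 => ?_, ?_⟩
  · have := H z (hz.trans hrr₁)
    rw [hz0, norm_zero] at this
    have h0 : ‖z - w‖ ≤ 0 := nonpos_of_mul_nonpos_right this hc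
    exact sub_eq_zero.1 (norm_le_zero_iff.1 h0)
  · filter_upwards [HK, HK₀, eventually_ge_atTop 1, eventually_mul_step_sq_lt K hδ,
      eventually_mul_step_sq_lt K (show 0 < c * r / 4 by positivity)] with m hm hm₀ hm1 hmδ hmc
    set P := discChar q m with hP
    have hPw : ‖P.eval w‖ ≤ K * step (2 * m - 1) ^ 2 := by
      have := (hm w (hnorm w (by simpa using hr.le))).2
      rwa [hw0, sub_zero] at this
    -- On the circle `‖Δ‖ ≥ c r`, while the errors at `z` and at `w` are each below `c r / 4`.
    have hsph : ∀ z ∈ Metric.sphere w r, c * r / 2 ≤ ‖P.eval z - P.eval w‖ := by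
      intro z hz
      have hz' : ‖z - w‖ = r := by simpa [dist_eq_norm] using hz
      have h1 := H z (hz'.le.trans hrr₁)
      rw [hz'] at h1
      have h2 := (hm z (hnorm z hz'.le)).2
      have h3 : ‖charFun (Real.pi / 2) q z‖ ≤ ‖P.eval z - P.eval w‖ +
          ‖P.eval z - charFun (Real.pi / 2) q z‖ + ‖P.eval w‖ := by
        have e : charFun (Real.pi / 2) q z = (P.eval z - P.eval w) -
          (P.eval z - charFun (Real.pi / 2) q z) + P.eval w := by ring
        calc ‖charFun (Real.pi / 2) q z‖ = ‖(P.eval z - P.eval w) -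
              (P.eval z - charFun (Real.pi / 2) q z) + P.eval w‖ := by rw [← e]
          _ ≤ _ := (norm_add_le _ _).trans (add_le_add (norm_sub_le _ _) le_rfl)
      linarith
    -- A polynomial constant near `w` is constant, against the bound on the circle.
    have hfreq : ∃ᶠ z in 𝓝 w, P.eval z ≠ P.eval w := by
      intro hev
      simp only [not_not] at hev
      have hinf : {z | P.eval z = (C (P.eval w)).eval z}.Infinite := by
        refine infinite_of_mem_nhds w ?_
        filter_upwards [hev] with z hz
        simpa using hz
      have hPc := Polynomial.eq_of_infinite_eval_eq P (C (P.eval w)) hinf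
      have h1 := hsph (w + r) (by simp [hr.le])
      rw [hPc] at h1
      simp only [eval_C, sub_self, norm_zero] at h1
      have : 0 < c * r / 2 := by positivity
      linarith
    -- Quantitative open mapping: the image of the disc contains the ball of radius `c r / 4` about
    -- `P(w)`, hence zero.
    obtain ⟨z, hz, hz0⟩ := (P.differentiable.diffContOnCl).ball_subset_image_closedBall hr hsph
      hfreq (show (0 : ℂ) ∈ Metric.ball (P.eval w) (c * r / 2 / 2) by
        rw [Metric.mem_ball, dist_eq_norm, zero_sub, norm_neg]
        linarith)
    have hzr : ‖z - w‖ ≤ r := by simpa [dist_eq_norm] using hz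
    have hroot := (mem_roots_charpoly_iff q hm1 z).2 hz0
    refine ⟨z, hroot, fun hS => ?_, hm₀ z hroot (hzr.trans hrr₂)⟩
    -- If `s_m(z) = 0`, the kernel at `z` would be smaller than half its modulus at `w`, contrary to
    -- the choice of `r₃`.
    have h1 := (hm z (hnorm z hzr)).1
    rw [hS, zero_sub, norm_neg] at h1
    have h2 := Hs (x := z) (by simpa [dist_eq_norm] using hzr.trans hrr₃)
    linarith

/-! ### Enumerations of the roots and matching numberings -/

theorem exists_map_val_eq {α β : Type*} [DecidableEq α] (I : Finset α) (R : Multiset β)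
    (hcard : I.card = Multiset.card R) [Nonempty β] : ∃ g : α → β, I.val.map g = R := by
  induction I using Finset.induction_on generalizing R with
  | empty =>
    refine ⟨fun _ => Classical.arbitrary β, ?_⟩
    simpa [eq_comm] using hcard
  | insert a s ha ih =>
    rw [Finset.card_insert_of_notMem ha] at hcard
    obtain ⟨b, hb⟩ := Multiset.card_pos_iff_exists_mem.1 (by omega : 0 < Multiset.card R)
    obtain ⟨R', rfl⟩ := Multiset.exists_cons_of_mem hb
    rw [Multiset.card_cons, Nat.add_right_cancel_iff] at hcard
    obtain ⟨g, hg⟩ := ih R' hcard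
    refine ⟨Function.update g a b, ?_⟩
    rw [Finset.insert_val_of_notMem ha, Multiset.map_cons, Function.update_self, ← hg]
    congr 1
    refine Multiset.map_congr rfl fun x hx => Function.update_of_ne ?_ _ _
    rintro rfl
    exact ha hx

/-- An injective partial enumeration of a multiset extends to an enumeration. -/
theorem exists_map_val_eq_extending {α β : Type*} [DecidableEq α] [Nonempty β] {I B : Finset α}
    {R : Multiset β} (hcard : I.card = Multiset.card R) (hB : B ⊆ I) {f : α → β}
    (hinj : Set.InjOn f B) (hf : ∀ b ∈ B, f b ∈ R) :
    ∃ g : α → β, I.val.map g = R ∧ ∀ b ∈ B, g b = f b := by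
  have hle : B.val.map f ≤ R := by
    -- Injectivity leaves no repeated values, so only membership in `R` matters, not multiplicities.
    rw [Multiset.le_iff_subset (Multiset.Nodup.map_on (fun x hx y hy h => hinj hx hy h) B.nodup)]
    intro y hy
    obtain ⟨b, hb, rfl⟩ := Multiset.mem_map.1 hy
    exact hf b hb
  obtain ⟨R', rfl⟩ := Multiset.le_iff_exists_add.1 hle
  have hcard' : (I \ B).card = Multiset.card R' := by
    rw [Multiset.card_add, Multiset.card_map, Finset.card_val] at hcard
    rw [Finset.card_sdiff_of_subset hB]
    omega
  obtain ⟨g, hg⟩ := exists_map_val_eq (I \ B) R' hcard'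
  refine ⟨fun x => if x ∈ B then f x else g x, ?_, fun b hb => if_pos hb⟩
  have hI : I.val = B.val + (I \ B).val := by
    rw [← Finset.disjUnion_val B (I \ B) Finset.disjoint_sdiff, Finset.disjUnion_eq_union,
      Finset.union_sdiff_of_subset hB]
  rw [hI, Multiset.map_add, ← hg]
  congr 1
  · exact Multiset.map_congr rfl fun x hx => if_pos hx
  · exact Multiset.map_congr rfl fun x hx => if_neg (Finset.mem_sdiff.1 hx).2

/-- The degenerate eigenvalue of the discrete problem with the (even) number `n`. -/
def degenerateEigenvalue (m n : ℕ) : ℂ :=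
  ((4 * Real.sin ((n : ℝ) * step (2 * m - 1) / 2) ^ 2 / step (2 * m - 1) ^ 2 : ℝ) : ℂ)

theorem mul_step_lt_pi {m n : ℕ} (hn : n ≤ 2 * m - 1) : (n : ℝ) * step (2 * m - 1) < Real.pi := by
  have hpi := Real.pi_pos
  have : (n : ℝ) ≤ (2 * m - 1 : ℕ) := by exact_mod_cast hn
  rw [step, ← mul_div_assoc, div_lt_iff₀ (by positivity), mul_comm]
  exact mul_lt_mul_of_pos_left (by linarith) hpi

/-- For `θ = n h` with `n = 2 k` one has `m θ = k π`, as `m h = π / 2`; so `sin (m θ) = 0`, whereas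
`sin θ ≠ 0`. -/
theorem eval_discS_degenerateEigenvalue {m n : ℕ} (hn : Even n) (hn1 : 1 ≤ n)
    (hnm : n ≤ 2 * m - 1) :
    (discS (step (2 * m - 1)) m).eval (degenerateEigenvalue m n) = 0 := by
  have hm : 1 ≤ m := by omega
  have hpos := step_pos (2 * m - 1)
  have h := eval_discS_sin (step (2 * m - 1)) (n * step (2 * m - 1)) hpos.ne' m
  obtain ⟨k, rfl⟩ := hn
  have h1 : Real.sin (m * ((k + k : ℕ) * step (2 * m - 1))) = 0 := by
    have hm' : (m : ℝ) ≠ 0 := by positivity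
    rw [step_eq hm, show (m : ℝ) * ((k + k : ℕ) * (Real.pi / 2 / m)) = k * Real.pi by
      push_cast; field_simp; ring]
    exact Real.sin_nat_mul_pi k
  have h2 : Real.sin ((k + k : ℕ) * step (2 * m - 1)) ≠ 0 := by
    refine (Real.sin_pos_of_pos_of_lt_pi ?_ (mul_step_lt_pi hnm)).ne'
    have : (0 : ℝ) < (k + k : ℕ) := by exact_mod_cast hn1
    positivity
  rw [h1, Complex.ofReal_zero, mul_zero] at h
  exact (mul_eq_zero.1 h).resolve_right (by exact_mod_cast h2)

theorem degenerateEigenvalue_injOn (m : ℕ) :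
    Set.InjOn (degenerateEigenvalue m) (Set.Iic (2 * m - 1)) := by
  intro n hn n' hn' h
  have hpos := step_pos (2 * m - 1)
  have hpi := Real.pi_pos
  have key : ∀ k : ℕ, k ≤ 2 * m - 1 → (k : ℝ) * step (2 * m - 1) / 2 ∈
      Set.Icc (-(Real.pi / 2)) (Real.pi / 2) ∧
      0 ≤ Real.sin ((k : ℝ) * step (2 * m - 1) / 2) := fun k hk => by
    have h1 := mul_step_lt_pi hk
    have h2 : 0 ≤ (k : ℝ) * step (2 * m - 1) := by positivity
    exact ⟨⟨by linarith, by linarith⟩,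
      Real.sin_nonneg_of_nonneg_of_le_pi (by linarith) (by linarith)⟩
  have h1 := Complex.ofReal_injective h
  have h2 : Real.sin ((n : ℝ) * step (2 * m - 1) / 2) ^ 2 =
      Real.sin ((n' : ℝ) * step (2 * m - 1) / 2) ^ 2 := by
    field_simp at h1
    rw [mul_comm (n' : ℝ)]
    exact h1
  have h3 := (pow_left_inj₀ (key n hn).2 (key n' hn').2 two_ne_zero).1 h2
  have h4 := Real.injOn_sin (key n hn).1 (key n' hn').1 h3
  have h5 : (n : ℝ) = n' := by
    have : (n : ℝ) * step (2 * m - 1) = n' * step (2 * m - 1) := by linarith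
    exact mul_right_cancel₀ hpos.ne' this
  exact_mod_cast h5

theorem IsSimpleEigenvalue.analyticOrderAt_eq {a : ℝ} {q : ℝ → ℂ} {z : ℂ}
    (h : IsSimpleEigenvalue a q z) : analyticOrderAt (charFun a q) z = 1 := by
  have := h.2
  rwa [multiplicity, if_pos h.1] at this

theorem IsEigenvalueNumbering.eq_of_simple {q : ℝ → ℂ} {lam : ℕ → ℂ}
    (h : IsEigenvalueNumbering q lam) {n k : ℕ} (hn : 1 ≤ n) (hk : 1 ≤ k)
    (hs : IsSimpleEigenvalue (Real.pi / 2) q (lam n)) (he : lam k = lam n) : k = n := by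
  have h1 := h.count (lam n)
  rw [hs.2] at h1
  exact Set.encard_le_one_iff.1 h1.le k n ⟨hk, he⟩ ⟨hn, rfl⟩

/-- Every zero of the kernel is some `(2 k)²` and already occupies the even place `2 k`; a simple
eigenvalue is listed only once. -/
theorem IsEigenvalueNumbering.sinKernel_ne_zero {q : ℝ → ℂ} {lam : ℕ → ℂ}
    (h : IsEigenvalueNumbering q lam) {n : ℕ} (hn : Odd n)
    (hs : IsSimpleEigenvalue (Real.pi / 2) q (lam n)) :
    sinKernel (lam n) (Real.pi / 2) ≠ 0 := by
  intro h0
  obtain ⟨k, hk, hz⟩ := eq_sq_of_sinKernel_eq_zero h0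
  have := h.eq_of_simple hn.pos (k := 2 * k) (by omega) hs (by rw [h.even k hk, hz])
  exact Nat.not_odd_iff_even.2 (even_two_mul k) (this ▸ hn)

/-- Matching numberings exist. -/
theorem exists_matching_numbering {q : ℝ → ℂ} (hq : ContDiffOn ℝ 2 q (Set.Icc 0 Real.pi))
    {lam : ℕ → ℂ} (hlam : IsEigenvalueNumbering q lam) :
    ∃ mu : ℕ → ℕ → ℂ, IsDiscreteNumbering q mu ∧ Matches q lam mu := by
  classical
  have hex : ∀ n : ℕ, ∃ K : ℝ, ∃ r : ℝ, 0 < r ∧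
      (Odd n ∧ IsSimpleEigenvalue (Real.pi / 2) q (lam n) →
        (∀ z, ‖z - lam n‖ ≤ r → charFun (Real.pi / 2) q z = 0 → z = lam n) ∧
        ∀ᶠ m : ℕ in atTop, ∃ z ∈ (diffMatrix (2 * m - 1) m q).charpoly.roots,
          (discS (step (2 * m - 1)) m).eval z ≠ 0 ∧
            ‖z - lam n‖ ≤ K * step (2 * m - 1) ^ 2) := by
    intro n
    by_cases hn : Odd n ∧ IsSimpleEigenvalue (Real.pi / 2) q (lam n)
    · obtain ⟨K, r, hr, h⟩ := exists_root_near_simple_zero hq hn.2.analyticOrderAt_eq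
        (hlam.sinKernel_ne_zero hn.1 hn.2)
      exact ⟨K, r, hr, fun _ => h⟩
    · exact ⟨0, 1, one_pos, fun h => absurd h hn⟩
  choose K r hr H using hex
  -- The radius `r n / 3` keeps the choices apart: a common root would put two eigenvalues within `2
  -- / 3` of the larger radius, and in that disc the centre is the only zero of `Δ`.
  let good : ℕ → ℕ → ℂ → Prop := fun m n z =>
    z ∈ (diffMatrix (2 * m - 1) m q).charpoly.roots ∧ (discS (step (2 * m - 1)) m).eval z ≠ 0 ∧
      ‖z - lam n‖ ≤ K n * step (2 * m - 1) ^ 2 ∧ ‖z - lam n‖ ≤ r n / 3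
  -- For small `m` no good root need exist; such places are filled arbitrarily.
  let admissible : ℕ → ℕ → Prop := fun m n =>
    Odd n ∧ IsSimpleEigenvalue (Real.pi / 2) q (lam n) ∧ ∃ z, good m n z
  let near : ℕ → ℕ → ℂ := fun m n => if h : ∃ z, good m n z then h.choose else 0
  have hnear : ∀ m n, admissible m n → good m n (near m n) := fun m n h => by
    simp only [near, dif_pos h.2.2]
    exact h.2.2.choose_spec
  let f : ℕ → ℕ → ℂ := fun m n => if Even n then degenerateEigenvalue m n else near m n
  have hstep : ∀ m : ℕ, ∃ g : ℕ → ℂ, 1 ≤ m →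
      (Finset.Icc 1 (2 * m - 1)).val.map g = (diffMatrix (2 * m - 1) m q).charpoly.roots ∧
      ∀ n ∈ Finset.Icc 1 (2 * m - 1), Even n ∨ admissible m n → g n = f m n := by
    intro m
    by_cases hm : 1 ≤ m
    swap
    · exact ⟨0, fun h => absurd h hm⟩
    set B := (Finset.Icc 1 (2 * m - 1)).filter (fun n => Even n ∨ admissible m n) with hB
    obtain ⟨g, hg1, hg2⟩ := exists_map_val_eq_extending (I := Finset.Icc 1 (2 * m - 1)) (B := B)
      (R := (diffMatrix (2 * m - 1) m q).charpoly.roots) (f := f m)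
      (by rw [card_roots_charpoly, Nat.card_Icc, Nat.add_sub_cancel])
      (Finset.filter_subset _ _) (by
        -- Degenerate values are zeros of `s_m`, and good roots are not.
        have hmix : ∀ n n', n ∈ B → n' ∈ B → Even n → ¬ Even n' → f m n ≠ f m n' := by
          intro n n' hn hn' he he' heq
          simp only [hB, Finset.mem_filter, Finset.mem_Icc] at hn hn'
          simp only [f, if_pos he, if_neg he'] at heq
          have h1 := eval_discS_degenerateEigenvalue he hn.1.1 hn.1.2
          rw [heq] at h1
          exact (hnear m n' (hn'.2.resolve_left he')).2.1 h1
        intro n hn n' hn' heq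
        by_cases he : Even n <;> by_cases he' : Even n'
        · simp only [hB, Finset.coe_filter, Set.mem_ofPred_eq, Finset.mem_Icc] at hn hn'
          simp only [f, if_pos he, if_pos he'] at heq
          exact degenerateEigenvalue_injOn m hn.1.2 hn'.1.2 heq
        · exact absurd heq (hmix n n' hn hn' he he')
        · exact absurd heq.symm (hmix n' n hn' hn he' he)
        · simp only [hB, Finset.coe_filter, Set.mem_ofPred_eq, Finset.mem_Icc] at hn hn'
          simp only [f, if_neg he, if_neg he'] at heq
          have a := hn.2.resolve_left he
          have a' := hn'.2.resolve_left he'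
          have g1 := (hnear m n a).2.2.2
          have g2 := (hnear m n' a').2.2.2
          rw [← heq] at g2
          have hd : ‖lam n - lam n'‖ ≤ r n / 3 + r n' / 3 := by
            have e : lam n - lam n' = (near m n - lam n') - (near m n - lam n) := by ring
            rw [e]
            exact (norm_sub_le _ _).trans (by linarith)
          have hz := (exists_lower_bound_of_analyticOrderAt_eq_one a.2.1.analyticOrderAt_eq).1
          have hz' := (exists_lower_bound_of_analyticOrderAt_eq_one a'.2.1.analyticOrderAt_eq).1
          have hrn := hr n
          have hrn' := hr n'
          rcases le_total (r n) (r n') with hle | hle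
          · have := (H n' ⟨a'.1, a'.2.1⟩).1 (lam n) (by linarith) hz
            exact hlam.eq_of_simple hn'.1.1 hn.1.1 a'.2.1 this
          · have := (H n ⟨a.1, a.2.1⟩).1 (lam n') (by rw [norm_sub_rev]; linarith) hz'
            exact (hlam.eq_of_simple hn.1.1 hn'.1.1 a.2.1 this).symm) (by
        intro n hn
        simp only [hB, Finset.mem_filter, Finset.mem_Icc] at hn
        by_cases he : Even n
        · simp only [f, if_pos he]
          rw [mem_roots_charpoly_iff q hm, discChar, eval_mul, eval_mul,
            eval_discS_degenerateEigenvalue he hn.1.1 hn.1.2, zero_mul, zero_mul]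
        · simp only [f, if_neg he]
          exact (hnear m n (hn.2.resolve_left he)).1)
    exact ⟨g, fun _ => ⟨hg1, fun n hn h => hg2 n (Finset.mem_filter.2 ⟨hn, h⟩)⟩⟩
  choose g hg using hstep
  have hidx : ∀ m : ℕ, 1 ≤ m → (2 * m - 1 + 1) / 2 = m := fun m hm => by omega
  -- `mu` is indexed by `l = 2 m - 1`, from which `m` is recovered as `(l + 1) / 2`.
  refine ⟨fun l => g ((l + 1) / 2), ⟨fun m hm k hk hkm => ?_, fun m hm => ?_⟩,
    fun n hn _ hs => ?_⟩
  · simp only [hidx m hm]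
    rw [(hg m hm).2 (2 * k) (Finset.mem_Icc.2 ⟨by omega, by omega⟩) (Or.inl (even_two_mul k))]
    simp only [f, if_pos (even_two_mul k), degenerateEigenvalue]
  · simp only [hidx m hm]
    exact (hg m hm).1
  · rw [tendsto_iff_norm_sub_tendsto_zero]
    have hK : Tendsto (fun m : ℕ => K n * step (2 * m - 1) ^ 2) atTop (𝓝 0) := by
      simpa using (tendsto_step.pow 2).const_mul (K n)
    refine squeeze_zero' (Eventually.of_forall fun m => norm_nonneg _) ?_ hK
    filter_upwards [(H n ⟨hn, hs⟩).2, eventually_ge_atTop (n + 1),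
      eventually_mul_step_sq_lt (K n) (show 0 < r n / 3 by have := hr n; positivity)]
      with m hm hmn hmr
    obtain ⟨z, hz1, hz2, hz3⟩ := hm
    have hadm : admissible m n := ⟨hn, hs, z, hz1, hz2, hz3, hz3.trans hmr.le⟩
    have hn0 := hn.pos
    rw [hidx m (by omega), (hg m (by omega)).2 n (Finset.mem_Icc.2 ⟨by omega, by omega⟩)
      (Or.inr hadm)]
    simp only [f, if_neg (Nat.not_even_iff_odd.2 hn)]
    exact (hnear m n hadm).2.2.1

/-- For matching numberings, each simple nondegenerate eigenvalue is approximated with the second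
order of accuracy. -/
theorem matching_rate {q : ℝ → ℂ} (hq : ContDiffOn ℝ 2 q (Set.Icc 0 Real.pi)) {lam : ℕ → ℂ}
    {mu : ℕ → ℕ → ℂ} (hmu : IsDiscreteNumbering q mu) (hmatch : Matches q lam mu) {n : ℕ}
    (hn : Odd n) (h0 : lam n ≠ 0) (hs : IsSimpleEigenvalue (Real.pi / 2) q (lam n)) :
    ∃ K : ℝ, ∀ᶠ m : ℕ in atTop,
      ‖mu (2 * m - 1) n - lam n‖ ≤ K * step (2 * m - 1) ^ 2 := by
  obtain ⟨K, r, hr, H⟩ := roots_near_simple_zero hq hs.analyticOrderAt_eq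
  refine ⟨K, ?_⟩
  filter_upwards [H, eventually_ge_atTop (n + 1),
    (tendsto_iff_norm_sub_tendsto_zero.1 (hmatch n hn h0 hs)).eventually_lt_const hr]
    with m hm hmn hmr
  -- Matching places `mu` in the disc of radius `r`; it remains to see that it is a root, which
  -- needs `n ≤ 2 m - 1`.
  refine hm _ ?_ hmr.le
  have hn0 := hn.pos
  have hm1 : 1 ≤ m := by omega
  rw [← hmu.roots m hm1]
  have hmem : n ∈ Finset.Icc 1 (2 * m - 1) := Finset.mem_Icc.2 ⟨by omega, by omega⟩
  exact Multiset.mem_map_of_mem _ hmem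

end Numbering

end

end FrozenArgument


/-! ### The estimate uniform in `n ≤ n₀` -/

theorem mainTheorem5 (q : ℝ → ℂ) (hq : ContDiffOn ℝ 2 q (Set.Icc 0 Real.pi))
    (lam : ℕ → ℂ) (hlam : FrozenArgument.IsEigenvalueNumbering q lam) :
    (∃ mu : ℕ → ℕ → ℂ, FrozenArgument.IsDiscreteNumbering q mu ∧
      FrozenArgument.Matches q lam mu) ∧
    ∀ mu : ℕ → ℕ → ℂ, FrozenArgument.IsDiscreteNumbering q mu →
      FrozenArgument.Matches q lam mu →
      ∀ n₀ : ℕ, ∃ C : ℝ, ∃ M : ℕ, ∀ m : ℕ, M ≤ m →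
        ∀ n : ℕ, n ≤ n₀ → Odd n → lam n ≠ 0 →
          FrozenArgument.IsSimpleEigenvalue (Real.pi / 2) q (lam n) →
          ‖mu (2 * m - 1) n - lam n‖ ≤ C * FrozenArgument.step (2 * m - 1) ^ 2 := by
  refine ⟨FrozenArgument.exists_matching_numbering hq hlam, fun mu hmu hmatch n₀ => ?_⟩
  have hex : ∀ n : ℕ, ∃ K : ℝ, ∀ᶠ m : ℕ in atTop, Odd n → lam n ≠ 0 →
      FrozenArgument.IsSimpleEigenvalue (Real.pi / 2) q (lam n) →
      ‖mu (2 * m - 1) n - lam n‖ ≤ K * FrozenArgument.step (2 * m - 1) ^ 2 := by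
    intro n
    by_cases h : Odd n ∧ lam n ≠ 0 ∧ FrozenArgument.IsSimpleEigenvalue (Real.pi / 2) q (lam n)
    · obtain ⟨K, hK⟩ := FrozenArgument.matching_rate hq hmu hmatch h.1 h.2.1 h.2.2
      exact ⟨K, hK.mono fun m hm _ _ _ => hm⟩
    · exact ⟨0, Eventually.of_forall fun m h1 h2 h3 => absurd ⟨h1, h2, h3⟩ h⟩
  choose K hK using hex
  have hall : ∀ᶠ m : ℕ in atTop, ∀ n ∈ Finset.range (n₀ + 1), Odd n → lam n ≠ 0 →
      FrozenArgument.IsSimpleEigenvalue (Real.pi / 2) q (lam n) →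
      ‖mu (2 * m - 1) n - lam n‖ ≤ K n * FrozenArgument.step (2 * m - 1) ^ 2 :=
    (Filter.eventually_all_finset _).2 fun n _ => hK n
  obtain ⟨M, hM⟩ := eventually_atTop.1 hall
  -- The sum of absolute values dominates each of the finitely many constants, whatever their signs.
  refine ⟨∑ n ∈ Finset.range (n₀ + 1), |K n|, M, fun m hm n hn h1 h2 h3 => ?_⟩
  have hmem : n ∈ Finset.range (n₀ + 1) := Finset.mem_range.2 (by omega)
  refine (hM m hm n hmem h1 h2 h3).trans (mul_le_mul_of_nonneg_right ?_ (sq_nonneg _))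
  exact (le_abs_self _).trans
    (Finset.single_le_sum (f := fun n => |K n|) (fun i _ => abs_nonneg _) hmem)
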